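/- Let $n\ge 2$ and let $x_1,\dots,x_n$ be distinct points of the unit circle $\partial\mathbb{D}$. Then there are $m\in\mathbb{N}$, distinct points $a_1,\dots,a_m\in\mathbb{C}\setminus\{x_1,\dots,x_n\}$ and real charges $q_1,\dots,q_m$ such that unit charges at the $x_j$ are in total electrostatic equilibrium in the field generated by the charges $q_i$ at $a_i$, i.e. \[ \sum_{k\ne j}\frac{1}{x_j-x_k}+\sum_{i=1}^m\frac{q_i}{x_j-a_i}=0,\qquad j=1,\dots,n. \tag{1} \] Moreover, such generators are given by the following explicit construction. For a measure $\mu$ on $\partial\mathbb{D}$ let $\Phi_k(\cdot;\mu)$ and $\varphi_k(\cdot;\mu)$ be the monic orthogonal and the orthonormal polynomials obtained from $1,z,z^2,\dots$ by Gram--Schmidt in $L^2(\mu)$, let $\alpha_k(\mu)=-\overline{\Phi_{k+1}(0;\mu)}$ be the Verblunsky coefficients, and put $\varphi_k^*(z)=z^k\overline{\varphi_k(1/\bar z)}$. For a measure $\mu = w(\theta)\frac{d\theta}{2\pi}$ with differentiable weight $w$ and $|z|>1$ put \[ G_n(z)=i\int_0^{2\pi}\frac{|\varphi_{n-1}^*(e^{i\theta})|^2w'(\theta)}{z-e^{i\theta}}\frac{d\theta}{2\pi},\qquad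 D_n(z)=-iz\int_0^{2\pi}\frac{\varphi_{n-1}^*(e^{i\theta})^2w'(\theta)}{(z-e^{i\theta})e^{in\theta}}\frac{d\theta}{2\pi}, \] \[ J_n(z)=i\int_0^{2\pi}\frac{\varphi_{n-1}(e^{i\theta})^2w'(\theta)}{(z-e^{i\theta})e^{i(n-2)\theta}}\frac{d\theta}{2\pi}, \] \[ h_n(z;x;y)=\bar x\bigl(n(1-\bar y\alpha_{n-1})+zG_n(z)+\bar yD_n(z)\bigr)-z\bigl(J_n(z)-\bar yG_n(z)\bigr). \] Let $\mu_n=\frac1n\sum_{j=1}^n\delta_{x_j}$, $\beta=(-1)^{n+1}\prod_{j=1}^n\bar x_j$ and $d\nu_n=|\varphi_{n-1}(e^{i\theta};\mu_n)|^{-2}\frac{d\theta}{2\pi}$. Then: (a) $\nu_n$ is a probability measure; (b) for the measure $\nu_n$, the function $h_n(z;\beta;\beta)$ coincides on $\{|z|>1\}$ with a quotient $S_1(z)/S_2(z)$ of coprime polynomials; (c) for all polynomials $S_1$ and $S_2\not\equiv0$ such that $h_n(z;\beta;\beta)\,S_2(z)=S_1(z)$ for $|z|>1$ and such that no $x_j$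 is a common zero of $S_1$ and $S_2$ (in particular, for coprime ones), no $x_j$ is a zero of $S_1$ or of $S_2$, and (1) holds for the following generators: a charge $-\frac12$ at each zero of $S_1$, a charge $+\frac12$ at each zero of $S_2$ (zeros counted with multiplicity, charges at the same point added), and a charge $\frac12(1-n)$ at the origin. -/

import Mathlib

namespace CircleElectro

open Polynomial MeasureTheory

/-- The inner product `⟨p, q⟩ = ∫ conj (p z) q z dμ(z)` of two polynomials in `L²(μ)`. -/
noncomputable def polyInner (μ : Measure ℂ) (p q : ℂ[X]) : ℂ :=
  ∫ z, (starRingEnd ℂ) (p.eval z) * q.eval z ∂μ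

/-- Gram–Schmidt orthogonalization of `1, z, z², …` in `L²(μ)`:
the monic orthogonal polynomials `Φ_k(z; μ)`. -/
noncomputable def monicOP (μ : Measure ℂ) : ℕ → ℂ[X]
  | k => X ^ k - ∑ j : Fin k,
      C (polyInner μ (monicOP μ j) (X ^ k) / polyInner μ (monicOP μ j) (monicOP μ j))
        * monicOP μ j
  termination_by k => k
  decreasing_by all_goals exact j.2

/-- The orthonormal polynomials `φ_k(z; μ) = Φ_k(z; μ) / ‖Φ_k‖`. -/
noncomputable def orthonormalOP (μ : Measure ℂ) (k : ℕ) : ℂ[X] :=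
  C ((1 / Real.sqrt (∫ z, ‖(monicOP μ k).eval z‖ ^ 2 ∂μ) : ℝ) : ℂ) * monicOP μ k

/-- The reversed polynomial `p^*(z) = z^k conj (p (1 / conj z))` of a polynomial of degree
at most `k`: the coefficient of `z^i` is the conjugate of the coefficient of `z^(k-i)` in `p`. -/
noncomputable def revPoly (k : ℕ) (p : ℂ[X]) : ℂ[X] :=
  (p.map (starRingEnd ℂ)).reflect k

/-- The Verblunsky coefficient `α_k = - conj (Φ_{k+1}(0))`, i.e. the value at `0` of the
Szegő recursion `Φ_{k+1} = z Φ_k - conj α_k Φ_k^*`. -/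
noncomputable def verblunsky (μ : Measure ℂ) (k : ℕ) : ℂ :=
  -(starRingEnd ℂ) ((monicOP μ (k + 1)).eval 0)

/-- The point `e^{iθ}` of the unit circle. -/
noncomputable def expI (θ : ℝ) : ℂ := Complex.exp (θ * Complex.I)

/-- The measure `w(θ) dθ / (2π)` on the unit circle, as a measure on `ℂ`. -/
noncomputable def circleMeasure (w : ℝ → ℝ) : Measure ℂ :=
  ((volume.restrict (Set.Ioc 0 (2 * Real.pi))).withDensity
    (fun θ => ENNReal.ofReal (w θ / (2 * Real.pi)))).map expI

/-- `G_n(z)` for the measure `w(θ) dθ / (2π)`. -/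
noncomputable def Gfun (w : ℝ → ℝ) (n : ℕ) (z : ℂ) : ℂ :=
  Complex.I * ∫ θ in (0 : ℝ)..(2 * Real.pi),
    ((‖(revPoly (n - 1) (orthonormalOP (circleMeasure w) (n - 1))).eval (expI θ)‖ ^ 2 : ℝ) : ℂ)
      * ((deriv w θ : ℝ) : ℂ) / (z - expI θ) / (2 * Real.pi)

/-- `D_n(z)` for the measure `w(θ) dθ / (2π)`. -/
noncomputable def Dfun (w : ℝ → ℝ) (n : ℕ) (z : ℂ) : ℂ :=
  -Complex.I * z * ∫ θ in (0 : ℝ)..(2 * Real.pi),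
    ((revPoly (n - 1) (orthonormalOP (circleMeasure w) (n - 1))).eval (expI θ)) ^ 2
      * ((deriv w θ : ℝ) : ℂ) / ((z - expI θ) * expI θ ^ n) / (2 * Real.pi)

/-- `J_n(z)` for the measure `w(θ) dθ / (2π)`. -/
noncomputable def Jfun (w : ℝ → ℝ) (n : ℕ) (z : ℂ) : ℂ :=
  Complex.I * ∫ θ in (0 : ℝ)..(2 * Real.pi),
    ((orthonormalOP (circleMeasure w) (n - 1)).eval (expI θ)) ^ 2
      * ((deriv w θ : ℝ) : ℂ) / ((z - expI θ) * expI θ ^ ((n : ℤ) - 2)) / (2 * Real.pi)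

/-- `h_n(z; x; y)` for the measure `w(θ) dθ / (2π)`. -/
noncomputable def hfun (w : ℝ → ℝ) (n : ℕ) (z x y : ℂ) : ℂ :=
  (starRingEnd ℂ) x * (n * (1 - (starRingEnd ℂ) y * verblunsky (circleMeasure w) (n - 1))
      + z * Gfun w n z + (starRingEnd ℂ) y * Dfun w n z)
    - z * (Jfun w n z - (starRingEnd ℂ) y * Gfun w n z)

/-- The uniform probability measure on the points `x_1, …, x_n`. -/
noncomputable def uniformMeasure {n : ℕ} (x : Fin n → ℂ) : Measure ℂ :=
  (n : ENNReal)⁻¹ • ∑ j, Measure.dirac (x j)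

/-- `β = (-1)^(n+1) ∏ conj x_j`. -/
noncomputable def betaOf {n : ℕ} (x : Fin n → ℂ) : ℂ :=
  (-1) ^ (n + 1) * ∏ j, (starRingEnd ℂ) (x j)

/-- The Bernstein–Szegő weight `w(θ) = 1 / |φ_{n-1}(e^{iθ}; μ_n)|²`, where `μ_n` is the
uniform measure on the given points. -/
noncomputable def bsWeight {n : ℕ} (x : Fin n → ℂ) (θ : ℝ) : ℝ :=
  1 / ‖(orthonormalOP (uniformMeasure x) (n - 1)).eval (expI θ)‖ ^ 2

/-- Unit charges at the points `x_j` are in total electrostatic equilibrium in the field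
generated by charges `q_i` at the points `a_i`. -/
def TotalEquilibrium {n : ℕ} {ι : Type*} [Fintype ι]
    (x : Fin n → ℂ) (a : ι → ℂ) (q : ι → ℝ) : Prop :=
  ∀ j, ∑ k ∈ Finset.univ.erase j, 1 / (x j - x k) + ∑ i, (q i : ℂ) / (x j - a i) = 0

/-- The positions of the generators built from `S₁ / S₂`: the origin and all the zeros
of `S₁` and `S₂`. -/
noncomputable def genPoints (S₁ S₂ : ℂ[X]) : Finset ℂ :=
  insert 0 (S₁.roots.toFinset ∪ S₂.roots.toFinset)

/-- The total charge at `a`: `-1/2` for each zero of `S₁`, `+1/2` for each zero of `S₂` (zeros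
counted with multiplicity), and `(1 - n)/2` at the origin. -/
noncomputable def genCharge (n : ℕ) (S₁ S₂ : ℂ[X]) (a : ℂ) : ℝ :=
  -(1 / 2) * (S₁.rootMultiplicity a : ℝ) + 1 / 2 * (S₂.rootMultiplicity a : ℝ)
    + (if a = 0 then (1 - (n : ℝ)) / 2 else 0)

/-- `S₁ / S₂` represents the function `h` on `{|z| > 1}`. -/
def Represents (S₁ S₂ : ℂ[X]) (h : ℂ → ℂ) : Prop :=
  S₂ ≠ 0 ∧ ∀ z : ℂ, 1 < ‖z‖ → h z * S₂.eval z = S₁.eval z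

end CircleElectro

namespace CircleElectro

open Polynomial MeasureTheory

/-! Write `N = n - 1`, `φ = φ_N(·; μ_n)`, `b = conj β` and `P = z φ - b φ^*`.

Nodal polynomial: `P` is a nonzero multiple of `∏ (z - x_j)` (`prod_X_sub_C_eq_popuc`,
`exists_popuc_orthonormalOP`). Hence `P'' / P'` at `x_j` equals `2 ∑_{k ≠ j} 1 / (x_j - x_k)`.

Field: on the circle the Bernstein–Szegő weight is `ζ^N / W` with `W = φ φ^*`, where `φ` has its
zeros in the open disc and `φ^*` has none in the closed disc. So `φ` is again the orthonormal
polynomial of degree `N` for `ν_n`, the next Verblunsky coefficient is `0`, and `G`, `D`, `J` are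
Cauchy integrals of rational functions, evaluated by the location of their poles. The result is
`h_n(z; β; β) = F / (z φ²)` with `F = fieldNum N φ b` (`hfun_bernsteinWeight`).

Equilibrium: as polynomials, `F = b z φ P' - b (N φ - z φ') P`. At a zero of `P` this gives `F' / F
= P'' / P' + (1 - N) / z + 2 φ' / φ`; subtracting the logarithmic derivative of `z φ²` leaves `(S₁ /
S₂)' / (S₁ / S₂) = P'' / P' - N / z` (`field_eq_zero`). Half of this identity is the equilibrium
condition, with charge `-N / 2 = (1 - n) / 2` at the origin.

Total mass: for a measure on the circle, the mass is determined by `Φ_N` and its norm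
(`polyInner_one_one_eq`). These agree for `μ_n` and `ν_n`, so `ν_n` has mass `1`. -/

/-- All products `conj p * q` of polynomials are integrable. -/
def PolyIntegrable (μ : Measure ℂ) : Prop :=
  ∀ p q : ℂ[X], Integrable (fun z => (starRingEnd ℂ) (p.eval z) * q.eval z) μ

/-- The inner product of `L²(μ)` is definite on the polynomials of degree less than `K`. -/
def DefiniteBelow (μ : Measure ℂ) (K : ℕ) : Prop :=
  ∀ p : ℂ[X], p.degree < K → polyInner μ p p = 0 → p = 0

/-! ### Orthogonality of the Gram–Schmidt polynomials. -/

section General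

variable {μ : Measure ℂ}

lemma polyInner_add_right (hμ : PolyIntegrable μ) (p q r : ℂ[X]) :
    polyInner μ p (q + r) = polyInner μ p q + polyInner μ p r := by
  simp only [polyInner, eval_add, mul_add]
  exact integral_add (hμ p q) (hμ p r)

lemma polyInner_sub_right (hμ : PolyIntegrable μ) (p q r : ℂ[X]) :
    polyInner μ p (q - r) = polyInner μ p q - polyInner μ p r := by
  simp only [polyInner, eval_sub, mul_sub]
  exact integral_sub (hμ p q) (hμ p r)

lemma polyInner_C_mul_right (c : ℂ) (p q : ℂ[X]) :
    polyInner μ p (C c * q) = c * polyInner μ p q := by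
  simp only [polyInner, eval_mul, eval_C, ← integral_const_mul]
  congr 1; ext z; ring

lemma polyInner_sum_right (hμ : PolyIntegrable μ) {ι : Type*} (s : Finset ι) (p : ℂ[X])
    (f : ι → ℂ[X]) : polyInner μ p (∑ i ∈ s, f i) = ∑ i ∈ s, polyInner μ p (f i) := by
  simp only [polyInner, eval_finsetSum, Finset.mul_sum]
  exact integral_finsetSum _ fun i _ => hμ p (f i)

lemma conj_polyInner (p q : ℂ[X]) :
    (starRingEnd ℂ) (polyInner μ p q) = polyInner μ q p := by
  simp only [polyInner, ← integral_conj]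
  congr 1; ext z; simp [mul_comm]

lemma polyInner_eq_zero_symm {p q : ℂ[X]} (h : polyInner μ p q = 0) : polyInner μ q p = 0 := by
  rw [← conj_polyInner, h, map_zero]

lemma polyInner_self (p : ℂ[X]) : polyInner μ p p = ((∫ z, ‖p.eval z‖ ^ 2 ∂μ : ℝ) : ℂ) := by
  rw [polyInner, ← integral_complex_ofReal]
  congr 1; ext z
  rw [Complex.conj_mul']; push_cast; rfl

lemma monicOP_eq (μ : Measure ℂ) (k : ℕ) : monicOP μ k = X ^ k - ∑ j : Fin k,
      C (polyInner μ (monicOP μ j) (X ^ k) / polyInner μ (monicOP μ j) (monicOP μ j))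
        * monicOP μ j := by
  rw [monicOP]

lemma monicOP_monic_degree (μ : Measure ℂ) (k : ℕ) :
    (monicOP μ k).Monic ∧ (monicOP μ k).degree = k := by
  induction k using Nat.strong_induction_on with
  | _ k ih =>
    have hlt : (∑ j : Fin k,
        C (polyInner μ (monicOP μ j) (X ^ k) / polyInner μ (monicOP μ j) (monicOP μ j))
        * monicOP μ j).degree < k := by
      refine lt_of_le_of_lt (degree_sum_le _ _) ?_
      rw [Finset.sup_lt_iff (WithBot.bot_lt_coe _)]
      intro j _
      rw [← smul_eq_C_mul]
      calc _ ≤ _ := degree_smul_le _ _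
        _ = ((j : ℕ) : WithBot ℕ) := (ih j j.2).2
        _ < k := by exact_mod_cast j.2
    rw [monicOP_eq]
    refine ⟨(monic_X_pow k).sub_of_left (by simpa using hlt), ?_⟩
    rw [degree_sub_eq_left_of_degree_lt (by simpa using hlt), degree_X_pow]

lemma monicOP_monic (μ : Measure ℂ) (k : ℕ) : (monicOP μ k).Monic :=
  (monicOP_monic_degree μ k).1

lemma degree_monicOP (μ : Measure ℂ) (k : ℕ) : (monicOP μ k).degree = k :=
  (monicOP_monic_degree μ k).2

lemma natDegree_monicOP (μ : Measure ℂ) (k : ℕ) : (monicOP μ k).natDegree = k :=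
  natDegree_eq_of_degree_eq_some (degree_monicOP μ k)

lemma DefiniteBelow.polyInner_monicOP_ne_zero {K k : ℕ} (hd : DefiniteBelow μ K) (hk : k < K) :
    polyInner μ (monicOP μ k) (monicOP μ k) ≠ 0 := fun h =>
  (monicOP_monic μ k).ne_zero (hd _ (by rw [degree_monicOP]; exact_mod_cast hk) h)

/-- Gram–Schmidt divides only by norms of polynomials of degree below `k`, so `k = K` is allowed.
This matters for measures with finite support, where definiteness fails from some degree on. -/
lemma polyInner_monicOP_of_lt (hμ : PolyIntegrable μ) {K : ℕ} (hd : DefiniteBelow μ K)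
    (k : ℕ) (hk : k ≤ K) (j : ℕ) (hj : j < k) :
    polyInner μ (monicOP μ j) (monicOP μ k) = 0 := by
  induction k using Nat.strong_induction_on generalizing j with
  | _ k ih =>
    rw [monicOP_eq μ k, polyInner_sub_right hμ, polyInner_sum_right hμ,
      Finset.sum_eq_single (⟨j, hj⟩ : Fin k)]
    · rw [polyInner_C_mul_right,
        div_mul_cancel₀ _ (hd.polyInner_monicOP_ne_zero (hj.trans_le hk)), sub_self]
    · intro i _ hij
      rw [polyInner_C_mul_right]
      have hne : (i : ℕ) ≠ j := fun h => hij (Fin.ext h)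
      rcases lt_or_gt_of_ne hne with h | h
      · rw [polyInner_eq_zero_symm (ih j hj (hj.le.trans hk) i h), mul_zero]
      · rw [ih i i.2 (i.2.le.trans hk) j h, mul_zero]
    · simp

lemma polyInner_of_degree_lt {K k : ℕ} (hμ : PolyIntegrable μ) (hd : DefiniteBelow μ K)
    (hk : k ≤ K) (p : ℂ[X]) (hp : p.degree < k) : polyInner μ (monicOP μ k) p = 0 := by
  suffices H : ∀ m ≤ k, ∀ p : ℂ[X], p.degree < m → polyInner μ (monicOP μ k) p = 0 from
    H k le_rfl p hp
  intro m
  induction m with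
  | zero =>
    intro _ p hp
    have : p = 0 := by simpa using hp
    simp [this, polyInner]
  | succ m ih =>
    intro hm p hp
    have hlt : (p - C (p.coeff m) * monicOP μ m).degree < m := by
      rw [degree_lt_iff_coeff_zero]
      intro i hi
      rcases hi.eq_or_lt with rfl | hi
      · have := (monicOP_monic μ m).coeff_natDegree
        rw [natDegree_monicOP] at this
        simp [this]
      · have h1 : p.coeff i = 0 := coeff_eq_zero_of_degree_lt
          (hp.trans_le (by exact_mod_cast hi))
        have h2 : (monicOP μ m).coeff i = 0 := coeff_eq_zero_of_natDegree_lt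
          (by rw [natDegree_monicOP]; exact hi)
        simp [h1, h2]
    have h := ih (by omega) _ hlt
    rwa [polyInner_sub_right hμ, polyInner_C_mul_right,
      polyInner_eq_zero_symm (polyInner_monicOP_of_lt hμ hd k hk m (by omega)), mul_zero,
      sub_zero] at h

lemma polyInner_of_forall_X_pow {k : ℕ} (hμ : PolyIntegrable μ) (q : ℂ[X])
    (h : ∀ j < k, polyInner μ q (X ^ j) = 0) (p : ℂ[X]) (hp : p.degree < k) :
    polyInner μ q p = 0 := by
  rcases eq_or_ne p 0 with rfl | h0
  · simp [polyInner]
  rw [p.as_sum_range_C_mul_X_pow' ((natDegree_lt_iff_degree_lt h0).2 hp), polyInner_sum_right hμ]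
  refine Finset.sum_eq_zero fun j hj => ?_
  rw [polyInner_C_mul_right, h j (Finset.mem_range.1 hj), mul_zero]

/-- The monic orthogonal polynomial is characterized by its orthogonality relations. -/
lemma monicOP_unique {K k : ℕ} (hμ : PolyIntegrable μ) (hd : DefiniteBelow μ K)
    (hk : k ≤ K) (q : ℂ[X]) (hq : q.Monic) (hqd : q.degree = k)
    (h : ∀ j < k, polyInner μ q (X ^ j) = 0) : monicOP μ k = q := by
  have hlt : (monicOP μ k - q).degree < k := by
    rw [← degree_monicOP μ k]
    exact degree_sub_lt_left (by rw [degree_monicOP, hqd]) (monicOP_monic μ k).ne_zero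
      (by rw [monicOP_monic μ k, hq])
  refine sub_eq_zero.1 (hd _ (hlt.trans_le (by exact_mod_cast hk)) ?_)
  rw [polyInner_sub_right hμ,
    polyInner_eq_zero_symm (polyInner_of_degree_lt hμ hd hk _ hlt),
    polyInner_eq_zero_symm (polyInner_of_forall_X_pow hμ q h _ hlt), sub_zero]

end General

/-! ### Means over the unit circle and polynomial reversal. -/

section Circle

lemma norm_expI (θ : ℝ) : ‖expI θ‖ = 1 := Complex.norm_exp_ofReal_mul_I θ

lemma expI_ne_zero (θ : ℝ) : expI θ ≠ 0 := Complex.exp_ne_zero _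

lemma continuous_expI : Continuous expI := by unfold expI; fun_prop

lemma hasDerivAt_expI (θ : ℝ) : HasDerivAt expI (Complex.I * expI θ) θ := by
  have h : HasDerivAt (fun t : ℝ => (t : ℂ) * Complex.I) (1 * Complex.I) θ :=
    (Complex.ofRealCLM.hasDerivAt (x := θ)).mul_const Complex.I
  have := h.cexp
  rw [one_mul, mul_comm] at this
  exact this

/-- The mean of a function over the unit circle. -/
noncomputable def circleMean (F : ℂ → ℂ) : ℂ :=
  ∫ θ in (0 : ℝ)..(2 * Real.pi), F (expI θ) / (2 * Real.pi)

lemma circleMean_congr {F G : ℂ → ℂ} (h : ∀ ζ : ℂ, ‖ζ‖ = 1 → F ζ = G ζ) :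
    circleMean F = circleMean G := by
  unfold circleMean
  simp_rw [h _ (norm_expI _)]

lemma circleMean_const_mul (c : ℂ) (F : ℂ → ℂ) :
    circleMean (fun ζ => c * F ζ) = c * circleMean F := by
  simp only [circleMean, ← intervalIntegral.integral_const_mul, mul_div_assoc]

lemma continuous_comp_expI {F : ℂ → ℂ} (hF : ContinuousOn F (Metric.sphere 0 1)) :
    Continuous fun θ => F (expI θ) :=
  hF.comp_continuous continuous_expI fun θ => by simp [norm_expI]

lemma circleMean_add {F G : ℂ → ℂ} (hF : ContinuousOn F (Metric.sphere 0 1))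
    (hG : ContinuousOn G (Metric.sphere 0 1)) :
    circleMean (fun ζ => F ζ + G ζ) = circleMean F + circleMean G := by
  simp only [circleMean, add_div]
  exact intervalIntegral.integral_add
    (((continuous_comp_expI hF).div_const _).intervalIntegrable _ _)
    (((continuous_comp_expI hG).div_const _).intervalIntegrable _ _)

lemma circleMean_conj (F : ℂ → ℂ) :
    circleMean (fun ζ => (starRingEnd ℂ) (F ζ)) = (starRingEnd ℂ) (circleMean F) := by
  simp only [circleMean, intervalIntegral.integral_of_le Real.two_pi_pos.le, ← integral_conj]
  simp [Complex.conj_ofNat]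

lemma circleMean_eq_circleAverage (F : ℂ → ℂ) :
    circleMean F = Real.circleAverage F 0 1 := by
  simp [circleMean, Real.circleAverage_def, circleMap, expI, div_eq_inv_mul]

lemma continuousOn_eval_div {s : Set ℂ} (P Q : ℂ[X]) (hQ : ∀ ζ ∈ s, Q.eval ζ ≠ 0) :
    ContinuousOn (fun ζ => P.eval ζ / Q.eval ζ) s :=
  P.continuous.continuousOn.div Q.continuous.continuousOn hQ

/-- Mean value property for a quotient without poles in the closed disc. -/
lemma circleMean_eval_div (P Q : ℂ[X]) (hQ : ∀ ζ : ℂ, ‖ζ‖ ≤ 1 → Q.eval ζ ≠ 0) :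
    circleMean (fun ζ => P.eval ζ / Q.eval ζ) = P.eval 0 / Q.eval 0 := by
  rw [circleMean_eq_circleAverage]
  refine circleAverage_of_differentiable_on_off_countable (c := 0) (s := ∅)
    Set.countable_empty ?_ ?_
  · exact continuousOn_eval_div P Q fun ζ hζ => hQ ζ (by simpa using hζ)
  · intro ζ hζ
    exact P.differentiableAt.div Q.differentiableAt
      (hQ ζ (by have : ‖ζ‖ < 1 := by simpa using hζ
                exact this.le))

lemma eval_revPoly {k : ℕ} {p : ℂ[X]} (hp : p.natDegree ≤ k) {z : ℂ} (hz : z ≠ 0) :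
    (revPoly k p).eval z = z ^ k * (starRingEnd ℂ) (p.eval ((starRingEnd ℂ) z)⁻¹) := by
  let _ : Invertible z⁻¹ := invertibleOfNonzero (inv_ne_zero hz)
  have h := eval₂_reflect_mul_pow (RingHom.id ℂ) z⁻¹ k (p.map (starRingEnd ℂ))
    (natDegree_map_le.trans hp)
  simp only [invOf_eq_inv, inv_inv, eval₂_id, inv_pow] at h
  have h' := Polynomial.eval_map_apply (f := starRingEnd ℂ) (p := p) ((starRingEnd ℂ) z)⁻¹
  rw [map_inv₀, Complex.conj_conj] at h'
  rw [revPoly, ← h', ← h, mul_left_comm, mul_inv_cancel₀ (pow_ne_zero k hz), mul_one]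

lemma conj_eq_inv_of_norm_eq_one {ζ : ℂ} (hζ : ‖ζ‖ = 1) : (starRingEnd ℂ) ζ = ζ⁻¹ :=
  (Complex.inv_eq_conj hζ).symm

lemma eval_revPoly_of_norm_eq_one {k : ℕ} {p : ℂ[X]} (hp : p.natDegree ≤ k) {ζ : ℂ}
    (hζ : ‖ζ‖ = 1) : (revPoly k p).eval ζ = ζ ^ k * (starRingEnd ℂ) (p.eval ζ) := by
  rw [eval_revPoly hp (by rintro rfl; simp at hζ), conj_eq_inv_of_norm_eq_one hζ, inv_inv]

lemma eval_zero_revPoly (k : ℕ) (p : ℂ[X]) :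
    (revPoly k p).eval 0 = (starRingEnd ℂ) (p.coeff k) := by
  rw [← coeff_zero_eq_eval_zero, revPoly, coeff_reflect, revAt_zero, coeff_map]

lemma natDegree_revPoly_le {k : ℕ} {p : ℂ[X]} (hp : p.natDegree ≤ k) :
    (revPoly k p).natDegree ≤ k :=
  natDegree_reflect_le.trans (max_le le_rfl (natDegree_map_le.trans hp))

/-- Reversal reflects nonzero zeros in the circle, `a ↦ 1 / conj a`, and the value at `0` is the
conjugate leading coefficient. -/
lemma eval_revPoly_ne_zero {Q : ℂ[X]} (h0 : Q ≠ 0) (hQ : ∀ ζ : ℂ, Q.eval ζ = 0 → ‖ζ‖ < 1)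
    {ζ : ℂ} (hζ : ‖ζ‖ ≤ 1) : (revPoly Q.natDegree Q).eval ζ ≠ 0 := by
  rcases eq_or_ne ζ 0 with rfl | hne
  · rw [eval_zero_revPoly]
    simpa using h0
  · rw [eval_revPoly le_rfl hne]
    refine mul_ne_zero (pow_ne_zero _ hne) fun h => ?_
    have := hQ _ ((map_eq_zero _).1 h)
    rw [norm_inv, RCLike.norm_conj] at this
    exact absurd ((one_le_inv₀ (norm_pos_iff.2 hne)).2 hζ) (not_le.2 this)

/-- The mean of a quotient with poles in the open disc and vanishing at infinity to order one. -/
lemma circleMean_eval_div_eq_zero (P Q : ℂ[X]) (hPQ : P.natDegree < Q.natDegree)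
    (hQ : ∀ ζ : ℂ, Q.eval ζ = 0 → ‖ζ‖ < 1) :
    circleMean (fun ζ => P.eval ζ / Q.eval ζ) = 0 := by
  have h0 : Q ≠ 0 := by rintro rfl; simp at hPQ
  rw [← map_eq_zero (starRingEnd ℂ), ← circleMean_conj]
  -- On the circle, `conj (P / Q) = ζ P^* / Q^*`, with `P` reversed at degree `Q.natDegree - 1`. The
  -- strict degree inequality supplies the factor `ζ`, which makes the mean vanish.
  have key := circleMean_eval_div (X * revPoly (Q.natDegree - 1) P) (revPoly Q.natDegree Q)
    fun ζ hζ => eval_revPoly_ne_zero h0 hQ hζ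
  simp only [eval_mul, eval_X, zero_mul, zero_div] at key
  rw [← key]
  refine circleMean_congr fun ζ hζ => ?_
  have hne : ζ ≠ 0 := by rintro rfl; simp at hζ
  have hQζ : Q.eval ζ ≠ 0 := fun h => (hQ ζ h).ne hζ
  rw [eval_revPoly_of_norm_eq_one (Nat.le_sub_one_of_lt hPQ) hζ,
    eval_revPoly_of_norm_eq_one le_rfl hζ, map_div₀, ← mul_assoc, ← pow_succ',
    Nat.sub_add_cancel (by omega), mul_div_mul_left _ _ (pow_ne_zero _ hne)]

/-- Subtracting `P(z) / Q(z)` from `P / Q` cancels the pole at `z` and leaves `-K / (Q(z) Q)`, of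
mean zero since all its poles are inside and `K` has smaller degree than `Q`. The subtracted
constant over `z - ζ` is handled by the mean value property. -/
lemma circleMean_eval_div_mul_sub (P Q : ℂ[X]) (hPQ : P.natDegree < Q.natDegree)
    (hQ : ∀ ζ : ℂ, Q.eval ζ = 0 → ‖ζ‖ < 1) {z : ℂ} (hz : 1 < ‖z‖) :
    circleMean (fun ζ => P.eval ζ / Q.eval ζ / (z - ζ)) = P.eval z / Q.eval z / z := by
  have hQz : Q.eval z ≠ 0 := fun h => (hQ z h).not_gt hz
  have hz0 : z ≠ 0 := by rintro rfl; simp at hz; linarith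
  obtain ⟨K, hK⟩ : X - C z ∣ C (Q.eval z) * P - C (P.eval z) * Q := by
    rw [dvd_iff_isRoot]; simp [mul_comm]
  have hKd : K.natDegree < Q.natDegree := by
    rcases eq_or_ne K 0 with rfl | hK0
    · simp; omega
    have h1 : ((X - C z) * K).natDegree = 1 + K.natDegree := by
      rw [natDegree_mul (X_sub_C_ne_zero z) hK0, natDegree_X_sub_C]
    have h2 : (C (Q.eval z) * P - C (P.eval z) * Q).natDegree ≤ Q.natDegree :=
      (natDegree_sub_le _ _).trans (max_le ((natDegree_C_mul_le _ _).trans hPQ.le)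
        (natDegree_C_mul_le _ _))
    rw [hK, h1] at h2
    omega
  have hne : ∀ ζ : ℂ, ‖ζ‖ ≤ 1 → z - ζ ≠ 0 := fun ζ hζ h => by
    rw [sub_eq_zero.1 h] at hz; exact absurd hz hζ.not_gt
  have hsph : ∀ ζ : ℂ, ‖ζ‖ = 1 → Q.eval ζ ≠ 0 := fun ζ hζ h => (hQ ζ h).ne hζ
  have hA := circleMean_eval_div (C (P.eval z / Q.eval z)) (C z - X)
    fun ζ hζ => by simpa using hne ζ hζ
  have hB := circleMean_eval_div_eq_zero (C (-(Q.eval z)⁻¹) * K) Q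
    ((natDegree_C_mul_le _ _).trans_lt hKd) hQ
  have hAB := circleMean_add
    (continuousOn_eval_div (s := Metric.sphere 0 1) (C (P.eval z / Q.eval z)) (C z - X)
      fun ζ hζ => by simpa using hne ζ (by simpa using hζ.le))
    (continuousOn_eval_div (s := Metric.sphere 0 1) (C (-(Q.eval z)⁻¹) * K) Q
      fun ζ hζ => hsph ζ (by simpa using hζ))
  rw [hA, hB] at hAB
  simp only [eval_C, eval_sub, eval_X, sub_zero, add_zero, eval_mul] at hAB
  rw [← hAB]
  refine circleMean_congr fun ζ hζ => ?_
  have h := congrArg (eval ζ) hK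
  simp only [eval_sub, eval_mul, eval_C, eval_X] at h
  have h1 := hne ζ hζ.le
  have h2 := hsph ζ hζ
  field_simp
  linear_combination h

end Circle

/-! ### Integration against the two kinds of measures. -/

section Measures

lemma integral_uniformMeasure {n : ℕ} (x : Fin n → ℂ) (f : ℂ → ℂ) :
    ∫ z, f z ∂(uniformMeasure x) = (n : ℂ)⁻¹ * ∑ j, f (x j) := by
  rw [uniformMeasure, integral_smul_measure, integral_finsetSum_measure]
  · simp [integral_dirac]
  · intro i _
    exact integrable_dirac (by simp)

lemma polyIntegrable_uniformMeasure {n : ℕ} (hn : n ≠ 0) (x : Fin n → ℂ) :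
    PolyIntegrable (uniformMeasure x) := by
  intro p q
  refine Integrable.smul_measure ?_ (by simpa using hn)
  rw [integrable_finsetSum_measure]
  exact fun i _ => integrable_dirac enorm_lt_top

lemma integral_circleMeasure {w : ℝ → ℝ} (hw : Continuous w) (hpos : ∀ θ, 0 ≤ w θ)
    {f : ℂ → ℂ} (hf : Continuous f) :
    ∫ z, f z ∂(circleMeasure w)
      = ∫ θ in (0 : ℝ)..(2 * Real.pi), f (expI θ) * w θ / (2 * Real.pi) := by
  rw [circleMeasure, integral_map continuous_expI.aemeasurable hf.aestronglyMeasurable,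
    integral_withDensity_eq_integral_toReal_smul (by fun_prop) (by simp),
    intervalIntegral.integral_of_le Real.two_pi_pos.le]
  congr 1; ext θ
  rw [ENNReal.toReal_ofReal (by have := hpos θ; positivity)]
  simp; ring

lemma isFiniteMeasure_circleMeasure {w : ℝ → ℝ} (hw : Continuous w) :
    IsFiniteMeasure (circleMeasure w) := by
  have : IsFiniteMeasure ((volume.restrict (Set.Ioc 0 (2 * Real.pi))).withDensity
      (fun θ => ENNReal.ofReal (w θ / (2 * Real.pi)))) := by
    apply isFiniteMeasure_withDensity_ofReal
    exact ((hw.div_const _).integrableOn_Icc.mono_set Set.Ioc_subset_Icc_self).2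
  exact Measure.isFiniteMeasure_map _ _

lemma continuous_conj_eval_mul_eval (p q : ℂ[X]) :
    Continuous fun z : ℂ => (starRingEnd ℂ) (p.eval z) * q.eval z :=
  (Complex.continuous_conj.comp p.continuous).mul q.continuous

lemma polyIntegrable_circleMeasure {w : ℝ → ℝ} (hw : Continuous w) :
    PolyIntegrable (circleMeasure w) := by
  intro p q
  have hc := continuous_conj_eval_mul_eval p q
  have := isFiniteMeasure_circleMeasure hw
  rw [circleMeasure, integrable_map_measure hc.aestronglyMeasurable continuous_expI.aemeasurable]
  rw [integrable_withDensity_iff_integrable_smul' (by fun_prop) (by simp)]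
  refine ((Continuous.integrableOn_Icc ?_).mono_set Set.Ioc_subset_Icc_self)
  simp only [ENNReal.toReal_ofReal']
  exact ((hw.div_const _).max continuous_const).smul (hc.comp continuous_expI)

end Measures

/-! ### Orthogonal polynomials of measures on the circle. -/

section OnCircle

variable {μ ν : Measure ℂ}

lemma polyInner_congr_of_circle (hc : ∀ᵐ z ∂μ, ‖z‖ = 1) {p q r s : ℂ[X]}
    (h : ∀ z : ℂ, ‖z‖ = 1 → (starRingEnd ℂ) (p.eval z) * q.eval z
      = (starRingEnd ℂ) (r.eval z) * s.eval z) :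
    polyInner μ p q = polyInner μ r s :=
  integral_congr_ae (hc.mono fun z hz => h z hz)

lemma conj_mul_self_of_norm_eq_one {z : ℂ} (hz : ‖z‖ = 1) : (starRingEnd ℂ) z * z = 1 := by
  rw [Complex.conj_mul', hz]; simp

lemma polyInner_X_mul_X_mul (hc : ∀ᵐ z ∂μ, ‖z‖ = 1) (p q : ℂ[X]) :
    polyInner μ (X * p) (X * q) = polyInner μ p q := by
  refine polyInner_congr_of_circle hc fun z hz => ?_
  simp only [eval_mul, eval_X, map_mul]
  linear_combination (starRingEnd ℂ) (p.eval z) * q.eval z * conj_mul_self_of_norm_eq_one hz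

lemma polyInner_revPoly (hc : ∀ᵐ z ∂μ, ‖z‖ = 1) {k : ℕ} {p : ℂ[X]} (hp : p.natDegree ≤ k)
    (q : ℂ[X]) : polyInner μ (revPoly k p) q = polyInner μ (X ^ k) (p * q) := by
  refine polyInner_congr_of_circle hc fun z hz => ?_
  rw [eval_revPoly_of_norm_eq_one hp hz]
  simp; ring

/-- Zeros of orthogonal polynomials on the unit circle lie in the open disc. -/
lemma norm_lt_one_of_eval_monicOP_eq_zero (hc : ∀ᵐ z ∂μ, ‖z‖ = 1) (hμ : PolyIntegrable μ)
    {K k : ℕ} (hd : DefiniteBelow μ K) (hk : k < K) {a : ℂ}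
    (ha : (monicOP μ k).eval a = 0) : ‖a‖ < 1 := by
  obtain ⟨q, hq⟩ := dvd_iff_isRoot.2 ha
  have hq0 : q ≠ 0 := by
    rintro rfl; exact (monicOP_monic μ k).ne_zero (by simpa using hq)
  have hqd : q.degree < k := by
    rw [← degree_monicOP μ k, hq, mul_comm]
    rw [degree_mul, degree_X_sub_C, degree_eq_natDegree hq0]
    exact_mod_cast Nat.lt_succ_self _
  -- An orthogonal decomposition. Multiplication by `z` is isometric, so `‖q‖² = ‖Φ‖² + |a|² ‖q‖²`,
  -- which with `‖Φ‖ > 0` forces `|a| < 1`.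
  have hX : X * q = monicOP μ k + C a * q := by rw [hq]; ring
  have horth := polyInner_of_degree_lt hμ hd hk.le q hqd
  have h1 : polyInner μ q q = polyInner μ (monicOP μ k) (monicOP μ k)
      + a * (starRingEnd ℂ) a * polyInner μ q q := by
    have h2 : polyInner μ (X * q) (X * q) = polyInner μ (X * q) (monicOP μ k + C a * q) := by
      rw [← hX]
    rw [polyInner_X_mul_X_mul hc, polyInner_add_right hμ, polyInner_C_mul_right,
      ← conj_polyInner (monicOP μ k) (X * q), ← conj_polyInner q (X * q), hX,
      polyInner_add_right hμ, polyInner_add_right hμ, polyInner_C_mul_right,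
      polyInner_C_mul_right, horth, polyInner_eq_zero_symm horth] at h2
    simp only [map_mul, conj_polyInner, mul_zero, add_zero, zero_add] at h2
    linear_combination h2
  have hne := hd.polyInner_monicOP_ne_zero hk
  rw [polyInner_self, polyInner_self, Complex.mul_conj'] at h1
  rw [polyInner_self] at hne
  have hB : 0 < ∫ z, ‖(monicOP μ k).eval z‖ ^ 2 ∂μ :=
    lt_of_le_of_ne (integral_nonneg fun z => by positivity) fun h => hne (by rw [← h]; simp)
  have hA : 0 ≤ ∫ z, ‖q.eval z‖ ^ 2 ∂μ := integral_nonneg fun z => by positivity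
  have h3 : ∫ z, ‖q.eval z‖ ^ 2 ∂μ = (∫ z, ‖(monicOP μ k).eval z‖ ^ 2 ∂μ)
      + ‖a‖ ^ 2 * ∫ z, ‖q.eval z‖ ^ 2 ∂μ := by exact_mod_cast h1
  by_contra hcon
  have h4 : 1 ≤ ‖a‖ ^ 2 := one_le_pow₀ (not_lt.1 hcon)
  nlinarith

/-- A Bézout relation multiplied by `X ^ N` and reduced modulo `Q` bounds `b`; the identity itself
then bounds the degree of `a`. -/
lemma exists_bezout_X_pow {N : ℕ} {Q R : ℂ[X]} (hQ : Q.Monic) (hQd : Q.natDegree = N)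
    (hRd : R.natDegree ≤ N) (h : IsCoprime Q R) :
    ∃ a b : ℂ[X], a * Q + b * R = X ^ N ∧ a.natDegree ≤ N ∧ b.degree < N := by
  obtain ⟨u, v, huv⟩ := h
  have hQdeg : Q.degree = N := by rw [degree_eq_natDegree hQ.ne_zero, hQd]
  have hb : ((X ^ N * v) %ₘ Q).degree < N := hQdeg ▸ degree_modByMonic_lt _ hQ
  have hmd := modByMonic_add_div (X ^ N * v) Q
  have hab : (X ^ N * u + (X ^ N * v) /ₘ Q * R) * Q + (X ^ N * v) %ₘ Q * R = X ^ N := by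
    linear_combination X ^ N * huv + R * hmd
  refine ⟨_, _, hab, ?_, hb⟩
  set a := X ^ N * u + (X ^ N * v) /ₘ Q * R
  set b := (X ^ N * v) %ₘ Q
  have hbd : b.natDegree ≤ N := natDegree_le_of_degree_le hb.le
  have hle : (a * Q).natDegree ≤ N + N := by
    rw [eq_sub_of_add_eq hab]
    refine (natDegree_sub_le _ _).trans (max_le (by simp) ?_)
    exact natDegree_mul_le.trans (add_le_add hbd hRd)
  rcases eq_or_ne a 0 with h0 | h0
  · simp [h0]
  rw [natDegree_mul h0 hQ.ne_zero, hQd] at hle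
  omega

/-- The `N`-th orthogonal polynomial and its norm determine the total mass. -/
lemma polyInner_one_one_eq (hcμ : ∀ᵐ z ∂μ, ‖z‖ = 1) (hcν : ∀ᵐ z ∂ν, ‖z‖ = 1)
    (hμ : PolyIntegrable μ) (hν : PolyIntegrable ν) {N : ℕ} (hdμ : DefiniteBelow μ (N + 1))
    (hdν : DefiniteBelow ν (N + 1)) (hΦ : monicOP ν N = monicOP μ N)
    (hnorm : polyInner ν (monicOP μ N) (monicOP μ N) = polyInner μ (monicOP μ N) (monicOP μ N)) :
    polyInner ν 1 1 = polyInner μ 1 1 := by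
  set Φ := monicOP μ N with hΦdef
  have hΦd : Φ.natDegree = N := natDegree_monicOP μ N
  have hroot : ∀ a : ℂ, Φ.eval a = 0 → ‖a‖ < 1 := fun a ha =>
    norm_lt_one_of_eval_monicOP_eq_zero hcμ hμ hdμ (Nat.lt_succ_self N) ha
  have hΦm : Φ.Monic := monicOP_monic μ N
  -- All zeros of `Φ` lie in the open disc, where `Φ^*` has none.
  have hcop : IsCoprime Φ (revPoly N Φ) := by
    rw [isCoprime_iff_aeval_ne_zero_of_isAlgClosed (k := ℂ) ℂ]
    intro a
    simp only [coe_aeval_eq_eval]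
    by_cases h : Φ.eval a = 0
    · right
      have := eval_revPoly_ne_zero hΦm.ne_zero hroot (hroot a h).le
      rwa [hΦd] at this
    · exact Or.inl h
  obtain ⟨a, b, hab, had, hbd⟩ :=
    exists_bezout_X_pow hΦm hΦd (natDegree_revPoly_le hΦd.le) hcop
  -- The constant term `a(0)` depends on `Φ` alone. With `a Φ + b Φ^* = z^N`, the mass is `⟨z^N,
  -- z^N⟩ = ⟨a^*, Φ⟩ + ⟨Φ, b⟩`; here `⟨Φ, b⟩ = 0`, and only the leading term of `a^*`, with
  -- coefficient `conj a(0)`, contributes to `⟨a^*, Φ⟩`.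
  have key : ∀ ρ : Measure ℂ, (∀ᵐ z ∂ρ, ‖z‖ = 1) → PolyIntegrable ρ → DefiniteBelow ρ (N + 1) →
      monicOP ρ N = Φ → polyInner ρ 1 1 = a.eval 0 * polyInner ρ Φ Φ := by
    intro ρ hc hρ hd hΦρ
    have h1 : polyInner ρ 1 1 = polyInner ρ (X ^ N) (a * Φ + b * revPoly N Φ) := by
      rw [hab]
      refine polyInner_congr_of_circle hc fun z hz => ?_
      simp only [eval_one, map_one, eval_pow, eval_X]
      rw [conj_mul_self_of_norm_eq_one (by simp [hz]), one_mul]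
    have h2 : polyInner ρ (X ^ N) (b * revPoly N Φ) = polyInner ρ Φ b := by
      refine polyInner_congr_of_circle hc fun z hz => ?_
      rw [eval_mul, eval_revPoly_of_norm_eq_one hΦd.le hz]
      have : (starRingEnd ℂ) (z ^ N) * z ^ N = 1 :=
        conj_mul_self_of_norm_eq_one (by simp [hz])
      simp only [eval_pow, eval_X]
      linear_combination (starRingEnd ℂ) (Φ.eval z) * b.eval z * this
    have h3 : polyInner ρ Φ b = 0 := hΦρ ▸ polyInner_of_degree_lt hρ hd (Nat.le_succ N) b hbd
    have hlow : (revPoly N a - C ((starRingEnd ℂ) (a.eval 0)) * Φ).degree < N := by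
      rw [degree_lt_iff_coeff_zero]
      intro i hi
      rcases hi.eq_or_lt with rfl | hi
      · have h4 : Φ.coeff N = 1 := by simpa [hΦd] using hΦm.coeff_natDegree
        simp [h4, revPoly, coeff_reflect, revAt_le, coeff_zero_eq_eval_zero]
      · rw [coeff_sub, coeff_C_mul, coeff_eq_zero_of_natDegree_lt (p := Φ) (by omega),
          coeff_eq_zero_of_natDegree_lt ((natDegree_revPoly_le had).trans_lt hi)]
        simp
    have h5 := polyInner_of_degree_lt hρ hd (Nat.le_succ N) _ hlow
    rw [hΦρ, polyInner_sub_right hρ, polyInner_C_mul_right, sub_eq_zero] at h5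
    rw [h1, polyInner_add_right hρ, h2, h3, add_zero, ← polyInner_revPoly hc had,
      ← conj_polyInner, h5, map_mul, conj_polyInner, Complex.conj_conj]
  rw [key ν hcν hν hdν hΦ, key μ hcμ hμ hdμ rfl, hnorm]

end OnCircle

/-! ### The uniform measure on the nodes and their nodal polynomial. -/

section Uniform

variable {N : ℕ} {x : Fin (N + 1) → ℂ}

lemma ae_norm_eq_one_uniformMeasure (hx1 : ∀ j, ‖x j‖ = 1) :
    ∀ᵐ z ∂(uniformMeasure x), ‖z‖ = 1 := by
  refine Measure.ae_smul_measure ?_ _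
  rw [ae_finsetSum_measure_iff]
  intro i _
  simpa [ae_dirac_eq] using hx1 i

lemma eq_zero_of_degree_lt_of_eval_eq_zero (hx : Function.Injective x) {p : ℂ[X]}
    (hp : p.degree < (N + 1 : ℕ)) (h : ∀ j, p.eval (x j) = 0) : p = 0 := by
  by_contra h0
  exact h0 (eq_zero_of_natDegree_lt_card_of_eval_eq_zero p hx h
    (by simpa using (natDegree_lt_iff_degree_lt h0).2 hp))

lemma definiteBelow_uniformMeasure (hx : Function.Injective x) :
    DefiniteBelow (uniformMeasure x) (N + 1) := by
  intro p hp h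
  refine eq_zero_of_degree_lt_of_eval_eq_zero hx hp fun j => ?_
  rw [polyInner, integral_uniformMeasure, mul_eq_zero] at h
  have h2 := h.resolve_left (inv_ne_zero (by exact_mod_cast N.succ_ne_zero))
  simp only [Complex.conj_mul'] at h2
  have h3 : ∑ j, ‖p.eval (x j)‖ ^ 2 = 0 := by exact_mod_cast h2
  have := (Finset.sum_eq_zero_iff_of_nonneg fun i _ => by positivity).1 h3 j (Finset.mem_univ j)
  simpa using this

lemma polyInner_uniformMeasure_congr {p q r s : ℂ[X]}
    (hp : ∀ j, p.eval (x j) = r.eval (x j)) (hq : ∀ j, q.eval (x j) = s.eval (x j)) :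
    polyInner (uniformMeasure x) p q = polyInner (uniformMeasure x) r s := by
  simp only [polyInner, integral_uniformMeasure, hp, hq]

/-- The nodal polynomial of the points is the paraorthogonal polynomial of their
uniform measure. -/
lemma prod_X_sub_C_eq_popuc (hx : Function.Injective x) (hx1 : ∀ j, ‖x j‖ = 1) :
    X * monicOP (uniformMeasure x) N
      - C ((starRingEnd ℂ) (betaOf x)) * revPoly N (monicOP (uniformMeasure x) N)
      = ∏ j, (X - C (x j)) := by
  set μ := uniformMeasure x with hμdef
  have hc : ∀ᵐ z ∂μ, ‖z‖ = 1 := ae_norm_eq_one_uniformMeasure hx1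
  have hμ : PolyIntegrable μ := polyIntegrable_uniformMeasure N.succ_ne_zero x
  have hd : DefiniteBelow μ (N + 1) := definiteBelow_uniformMeasure hx
  set Φ := monicOP μ N with hΦdef
  have hΦm : Φ.Monic := monicOP_monic μ N
  have hΦd : Φ.natDegree = N := natDegree_monicOP μ N
  set Q : ℂ[X] := ∏ j, (X - C (x j)) with hQdef
  have hQm : Q.Monic := monic_prod_of_monic _ _ fun j _ => monic_X_sub_C _
  have hQd : Q.natDegree = N + 1 := by
    rw [hQdef, natDegree_prod_of_monic _ _ fun j _ => monic_X_sub_C _]; simp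
  have hQ0 : Q.eval 0 = -(starRingEnd ℂ) (betaOf x) := by
    rw [hQdef, eval_prod, betaOf]
    simp only [eval_sub, eval_X, eval_C, zero_sub, Finset.prod_neg]
    simp [map_prod]; ring
  have hR0 : (revPoly N Φ).eval 0 = 1 := by
    rw [eval_zero_revPoly, show Φ.coeff N = 1 by simpa [hΦd] using hΦm.coeff_natDegree, map_one]
  set c := (starRingEnd ℂ) (betaOf x) with hcdef
  -- The leading terms cancel, and `β` is chosen so that the constant terms cancel too. Hence `r = X
  -- s` with `s` of degree below `N`.
  set r := X * Φ - C c * revPoly N Φ - Q with hr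
  have hrd : r.degree < (N + 1 : ℕ) := by
    rw [degree_lt_iff_coeff_zero]
    intro i hi
    have hRi : (revPoly N Φ).coeff i = 0 :=
      coeff_eq_zero_of_natDegree_lt ((natDegree_revPoly_le hΦd.le).trans_lt hi)
    obtain ⟨i, rfl⟩ : ∃ k, i = k + 1 := ⟨i - 1, by omega⟩
    rw [hr, coeff_sub, coeff_sub, coeff_X_mul, coeff_C_mul, hRi]
    rcases hi.eq_or_lt with h | h
    · obtain rfl : i = N := by omega
      have h1 : Φ.coeff i = 1 := by simpa [hΦd] using hΦm.coeff_natDegree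
      have h2 : Q.coeff (i + 1) = 1 := by simpa [hQd] using hQm.coeff_natDegree
      rw [h1, h2]; simp
    · rw [coeff_eq_zero_of_natDegree_lt (p := Φ) (by omega),
        coeff_eq_zero_of_natDegree_lt (p := Q) (by omega)]; simp
  have hr0 : r.eval 0 = 0 := by simp [hr, hR0, hQ0]
  obtain ⟨s, hs⟩ : X ∣ r := X_dvd_iff.2 (by rw [coeff_zero_eq_eval_zero, hr0])
  have hsd : s.degree < N := by
    rw [degree_lt_iff_coeff_zero]
    intro i hi
    rw [← coeff_X_mul, ← hs]
    exact (degree_lt_iff_coeff_zero _ _).1 hrd _ (by omega)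
  have hQx : ∀ j, Q.eval (x j) = 0 := fun j => by
    rw [hQdef, eval_prod]
    exact Finset.prod_eq_zero (Finset.mem_univ j) (by simp)
  refine sub_eq_zero.1 (hd r hrd ?_)
  -- `Q` vanishes at every node and drops out of the inner product; `X s` is orthogonal to both `X
  -- Φ` and `Φ^*`.
  have h1 : polyInner μ r r = polyInner μ (X * s) (X * Φ - C c * revPoly N Φ) :=
    polyInner_uniformMeasure_congr (fun j => by rw [hs]) (fun j => by simp [hr, hQx])
  have h2 : polyInner μ s Φ = 0 :=
    polyInner_eq_zero_symm (polyInner_of_degree_lt hμ hd (Nat.le_succ N) s hsd)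
  have h3 : polyInner μ (X * s) (revPoly N Φ) = 0 := by
    -- The reversal below is at degree `N - 1`, which truncates for `N = 0`.
    rcases Nat.eq_zero_or_pos N with h0 | hpos
    · have : s = 0 := by simpa [h0] using hsd
      simp [this, polyInner]
    have hsn : s.natDegree ≤ N - 1 := by
      rcases eq_or_ne s 0 with rfl | hs0
      · simp
      · exact Nat.le_sub_one_of_lt ((natDegree_lt_iff_degree_lt hs0).2 hsd)
    have h4 : polyInner μ (X * s) (revPoly N Φ) = polyInner μ Φ (revPoly (N - 1) s) := by
      refine polyInner_congr_of_circle hc fun z hz => ?_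
      rw [eval_revPoly_of_norm_eq_one hΦd.le hz, eval_revPoly_of_norm_eq_one hsn hz]
      obtain ⟨M, rfl⟩ : ∃ M, N = M + 1 := ⟨N - 1, by omega⟩
      simp only [eval_mul, eval_X, map_mul, Nat.add_sub_cancel]
      linear_combination (starRingEnd ℂ) (s.eval z) * z ^ M * (starRingEnd ℂ) (Φ.eval z)
        * conj_mul_self_of_norm_eq_one hz
    rw [h4]
    refine polyInner_of_degree_lt hμ hd (Nat.le_succ N) _ ?_
    refine (degree_le_of_natDegree_le (natDegree_revPoly_le hsn)).trans_lt ?_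
    exact_mod_cast Nat.sub_lt hpos one_pos
  rw [h1, polyInner_sub_right hμ, polyInner_X_mul_X_mul hc, polyInner_C_mul_right, h2, h3]
  simp

end Uniform

/-! ### Bernstein–Szegő measures. -/

/-- The Bernstein–Szegő weight `1 / |φ(e^{iθ})|²`. -/
noncomputable def bernsteinWeight (φ : ℂ[X]) (θ : ℝ) : ℝ := 1 / ‖φ.eval (expI θ)‖ ^ 2

/-- The polynomial `N W - z dW/dz` with `W = φ φ^*`. -/
noncomputable def weightNum (N : ℕ) (φ : ℂ[X]) : ℂ[X] :=
  C (N : ℂ) * (φ * revPoly N φ) - X * derivative (φ * revPoly N φ)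

section Bernstein

variable {N : ℕ} {φ : ℂ[X]}

lemma eval_mul_revPoly_of_norm_eq_one (hd : φ.natDegree = N) {ζ : ℂ} (hζ : ‖ζ‖ = 1) :
    (φ * revPoly N φ).eval ζ = ζ ^ N * (‖φ.eval ζ‖ ^ 2 : ℝ) := by
  rw [eval_mul, eval_revPoly_of_norm_eq_one hd.le hζ]
  push_cast
  rw [← Complex.mul_conj']
  ring

lemma ofReal_bernsteinWeight (hd : φ.natDegree = N) (θ : ℝ) :
    (bernsteinWeight φ θ : ℂ) = expI θ ^ N / (φ * revPoly N φ).eval (expI θ) := by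
  rw [eval_mul_revPoly_of_norm_eq_one hd (norm_expI θ), bernsteinWeight,
    ← div_div, div_self (pow_ne_zero _ (expI_ne_zero θ))]
  push_cast; rfl

lemma eval_ne_zero_of_norm_eq_one (hr : ∀ a : ℂ, φ.eval a = 0 → ‖a‖ < 1) {ζ : ℂ}
    (hζ : ‖ζ‖ = 1) : φ.eval ζ ≠ 0 := fun h => (hr ζ h).ne hζ

lemma bernsteinWeight_pos (hr : ∀ a : ℂ, φ.eval a = 0 → ‖a‖ < 1) (θ : ℝ) :
    0 < bernsteinWeight φ θ := by
  have := norm_pos_iff.2 (eval_ne_zero_of_norm_eq_one hr (norm_expI θ))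
  unfold bernsteinWeight; positivity

lemma continuous_bernsteinWeight (hr : ∀ a : ℂ, φ.eval a = 0 → ‖a‖ < 1) :
    Continuous (bernsteinWeight φ) := by
  refine continuous_const.div ((φ.continuous.comp continuous_expI).norm.pow 2) fun θ => ?_
  exact pow_ne_zero _ (norm_ne_zero_iff.2 (eval_ne_zero_of_norm_eq_one hr (norm_expI θ)))

lemma eval_mul_revPoly_ne_zero (hd : φ.natDegree = N)
    (hr : ∀ a : ℂ, φ.eval a = 0 → ‖a‖ < 1) {ζ : ℂ} (hζ : ‖ζ‖ = 1) :
    (φ * revPoly N φ).eval ζ ≠ 0 := by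
  have hne : ζ ≠ 0 := by rintro rfl; simp at hζ
  have := eval_ne_zero_of_norm_eq_one hr hζ
  rw [eval_mul_revPoly_of_norm_eq_one hd hζ]
  refine mul_ne_zero (pow_ne_zero _ hne) ?_
  exact_mod_cast pow_ne_zero _ (norm_ne_zero_iff.2 this)

lemma ofReal_deriv_bernsteinWeight (hd : φ.natDegree = N)
    (hr : ∀ a : ℂ, φ.eval a = 0 → ‖a‖ < 1) (θ : ℝ) :
    ((deriv (bernsteinWeight φ) θ : ℝ) : ℂ) = Complex.I * expI θ ^ N *
      (weightNum N φ).eval (expI θ)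
        / (φ * revPoly N φ).eval (expI θ) ^ 2 := by
  set W := φ * revPoly N φ with hW
  have hWne : W.eval (expI θ) ≠ 0 := eval_mul_revPoly_ne_zero hd hr (norm_expI θ)
  have h1 : HasDerivAt (fun t => expI t ^ N) (N * expI θ ^ (N - 1) * (Complex.I * expI θ)) θ :=
    (hasDerivAt_expI θ).pow N
  have h2 : HasDerivAt (fun t => W.eval (expI t))
      ((derivative W).eval (expI θ) * (Complex.I * expI θ)) θ :=
    (W.hasDerivAt (expI θ)).comp θ (hasDerivAt_expI θ)
  have h3 := h1.div h2 hWne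
  set c := (N * expI θ ^ (N - 1) * (Complex.I * expI θ) * W.eval (expI θ) -
    expI θ ^ N * ((derivative W).eval (expI θ) * (Complex.I * expI θ))) / W.eval (expI θ) ^ 2
    with hc
  have h4 : HasDerivAt (fun t => (bernsteinWeight φ t : ℂ)) c θ := by
    refine h3.congr_of_eventuallyEq (Filter.Eventually.of_forall fun t => ?_)
    exact ofReal_bernsteinWeight hd t
  have h5 : HasDerivAt (bernsteinWeight φ) c.re θ := by
    have := (Complex.reCLM.hasFDerivAt (x := (bernsteinWeight φ θ : ℂ))).comp_hasDerivAt θ h4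
    simpa [Function.comp_def] using this
  rw [h5.deriv, h5.ofReal_comp.unique h4, hc]
  rw [weightNum, ← hW]
  simp only [eval_sub, eval_mul, eval_C, eval_X]
  congr 1
  -- Separates the truncated exponent `N - 1` at `N = 0`.
  rcases N with _ | M
  · simp; ring
  · simp; ring

lemma ae_norm_eq_one_circleMeasure (w : ℝ → ℝ) : ∀ᵐ z ∂(circleMeasure w), ‖z‖ = 1 := by
  rw [circleMeasure, ae_map_iff continuous_expI.aemeasurable]
  · exact Filter.Eventually.of_forall norm_expI
  · exact measurableSet_eq_fun measurable_norm measurable_const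

lemma polyInner_circleMeasure (hd : φ.natDegree = N)
    (hr : ∀ a : ℂ, φ.eval a = 0 → ‖a‖ < 1) (p q : ℂ[X]) :
    polyInner (circleMeasure (bernsteinWeight φ)) p q = circleMean fun ζ =>
      (starRingEnd ℂ) (p.eval ζ) * q.eval ζ * (ζ ^ N / (φ * revPoly N φ).eval ζ) := by
  rw [polyInner, integral_circleMeasure (continuous_bernsteinWeight hr)
    (fun θ => (bernsteinWeight_pos hr θ).le)
    (continuous_conj_eval_mul_eval p q), circleMean]
  simp only [ofReal_bernsteinWeight hd]

lemma infinite_range_expI : (Set.image expI (Set.Icc 0 (2 * Real.pi))).Infinite := by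
  have hinj : Set.InjOn expI (Set.Icc 0 Real.pi) := by
    intro a ha b hb h
    refine Real.injOn_cos ha hb ?_
    have := congrArg Complex.re h
    simpa [expI, Complex.exp_ofReal_mul_I_re] using this
  refine ((Set.Icc_infinite Real.pi_pos).image hinj).mono (Set.image_mono ?_)
  exact Set.Icc_subset_Icc_right (by linarith [Real.pi_pos])

lemma definiteBelow_circleMeasure (hr : ∀ a : ℂ, φ.eval a = 0 → ‖a‖ < 1) (K : ℕ) :
    DefiniteBelow (circleMeasure (bernsteinWeight φ)) K := by
  intro p _ h
  by_contra h0
  have hw := continuous_bernsteinWeight hr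
  rw [polyInner, integral_circleMeasure hw
    (fun θ => (bernsteinWeight_pos hr θ).le)
    (continuous_conj_eval_mul_eval p p)] at h
  have hcont : Continuous fun θ => ‖p.eval (expI θ)‖ ^ 2 * bernsteinWeight φ θ / (2 * Real.pi) :=
    (((p.continuous.comp continuous_expI).norm.pow 2).mul hw).div_const _
  have h2 : ∫ θ in (0 : ℝ)..(2 * Real.pi),
      ‖p.eval (expI θ)‖ ^ 2 * bernsteinWeight φ θ / (2 * Real.pi) = 0 := by
    rw [← Complex.ofReal_eq_zero, ← intervalIntegral.integral_ofReal, ← h]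
    congr 1; ext θ
    rw [Complex.conj_mul']; push_cast; rfl
  obtain ⟨θ, hθ, hne⟩ : ∃ θ ∈ Set.Icc 0 (2 * Real.pi), p.eval (expI θ) ≠ 0 := by
    by_contra! hcon
    refine h0 (eq_zero_of_infinite_isRoot p (infinite_range_expI.mono ?_))
    rintro _ ⟨θ, hθ, rfl⟩
    exact hcon θ hθ
  have hpos := intervalIntegral.integral_pos Real.two_pi_pos hcont.continuousOn
    (fun θ _ => by have := (bernsteinWeight_pos hr θ).le; have := Real.pi_pos; positivity)
    ⟨θ, hθ, by
      have := bernsteinWeight_pos hr θ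
      have := norm_pos_iff.2 hne
      have := Real.pi_pos
      positivity⟩
  exact hpos.ne' h2

/-- The weight cancels `φ`: the integrand is `ζ^(N + l - j) / φ^*`, analytic on the closed disc and
zero at the origin. -/
lemma polyInner_X_pow_circleMeasure (hd : φ.natDegree = N) (h0 : φ ≠ 0)
    (hr : ∀ a : ℂ, φ.eval a = 0 → ‖a‖ < 1) (l : ℕ) {j : ℕ} (hj : j < N + l) :
    polyInner (circleMeasure (bernsteinWeight φ)) (X ^ j) (X ^ l * φ) = 0 := by
  have hrev : ∀ ζ : ℂ, ‖ζ‖ ≤ 1 → (revPoly N φ).eval ζ ≠ 0 := fun ζ hζ =>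
    hd ▸ eval_revPoly_ne_zero h0 hr hζ
  have key := circleMean_eval_div (X ^ (N + l - j)) (revPoly N φ) hrev
  rw [eval_pow, eval_X, zero_pow (by omega), zero_div] at key
  rw [polyInner_circleMeasure hd hr, ← key]
  refine circleMean_congr fun ζ hζ => ?_
  have h1 := eval_ne_zero_of_norm_eq_one hr hζ
  have h2 := hrev ζ hζ.le
  have h3 : (starRingEnd ℂ) (ζ ^ j) * ζ ^ j = 1 := conj_mul_self_of_norm_eq_one (by simp [hζ])
  have h4 : ζ ^ (N + l) = ζ ^ (N + l - j) * ζ ^ j := by rw [← pow_add]; congr 1; omega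
  simp only [eval_mul, eval_pow, eval_X]
  field_simp
  rw [pow_add] at h4
  linear_combination (starRingEnd ℂ) (ζ ^ j) * h4 + ζ ^ (N + l - j) * h3

lemma polyInner_self_circleMeasure (hd : φ.natDegree = N)
    (hr : ∀ a : ℂ, φ.eval a = 0 → ‖a‖ < 1) :
    polyInner (circleMeasure (bernsteinWeight φ)) φ φ = 1 := by
  have key := circleMean_eval_div 1 1 (by simp)
  simp only [eval_one, div_one] at key
  rw [polyInner_circleMeasure hd hr, ← key]
  refine circleMean_congr fun ζ hζ => ?_
  have hne : ζ ≠ 0 := by rintro rfl; simp at hζ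
  have h1 := eval_mul_revPoly_ne_zero hd hr hζ
  rw [← mul_div_assoc, div_eq_one_iff_eq h1, eval_mul, eval_revPoly_of_norm_eq_one hd.le hζ]
  ring

variable {κ : ℝ} {Φ : ℂ[X]}

lemma monicOP_circleMeasure (hd : φ.natDegree = N)
    (hr : ∀ a : ℂ, φ.eval a = 0 → ‖a‖ < 1) (hκ : 0 < κ) (hΦ : Φ.Monic)
    (hφ : φ = C (κ : ℂ) * Φ) (l : ℕ) :
    monicOP (circleMeasure (bernsteinWeight φ)) (N + l) = X ^ l * Φ := by
  have hκ0 : (κ : ℂ) ≠ 0 := by exact_mod_cast hκ.ne'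
  have hΦd : Φ.natDegree = N := by rw [← hd, hφ, natDegree_C_mul hκ0]
  have h0 : φ ≠ 0 := by rw [hφ]; exact mul_ne_zero (C_ne_zero.2 hκ0) hΦ.ne_zero
  have hm : (X ^ l * Φ).Monic := (monic_X_pow l).mul hΦ
  refine monicOP_unique (polyIntegrable_circleMeasure (continuous_bernsteinWeight hr))
    (definiteBelow_circleMeasure hr (N + l)) le_rfl _ hm ?_ fun j hj => ?_
  · rw [degree_eq_natDegree hm.ne_zero, (monic_X_pow l).natDegree_mul hΦ, hΦd, natDegree_X_pow,
      add_comm]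
  · have h := polyInner_X_pow_circleMeasure hd h0 hr l hj
    have h2 : X ^ l * φ = C (κ : ℂ) * (X ^ l * Φ) := by rw [hφ]; ring
    rw [h2, polyInner_C_mul_right] at h
    exact polyInner_eq_zero_symm ((mul_eq_zero.1 h).resolve_left hκ0)

lemma orthonormalOP_circleMeasure (hd : φ.natDegree = N)
    (hr : ∀ a : ℂ, φ.eval a = 0 → ‖a‖ < 1) (hκ : 0 < κ) (hΦ : Φ.Monic)
    (hφ : φ = C (κ : ℂ) * Φ) :
    orthonormalOP (circleMeasure (bernsteinWeight φ)) N = φ := by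
  have hM : monicOP (circleMeasure (bernsteinWeight φ)) N = Φ := by
    simpa using monicOP_circleMeasure hd hr hκ hΦ hφ 0
  have h1 := polyInner_self_circleMeasure hd hr
  rw [polyInner_self] at h1
  have h2 : ∫ z, ‖φ.eval z‖ ^ 2 ∂(circleMeasure (bernsteinWeight φ)) = 1 := by exact_mod_cast h1
  have h3 : ∀ z, ‖φ.eval z‖ ^ 2 = κ ^ 2 * ‖Φ.eval z‖ ^ 2 := fun z => by
    rw [hφ]; simp [mul_pow]
  simp only [h3, integral_const_mul] at h2
  rw [orthonormalOP, hM]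
  conv_rhs => rw [hφ]
  rw [eq_div_of_mul_eq (by positivity) (mul_comm _ _ |>.trans h2), Real.sqrt_div zero_le_one,
    Real.sqrt_one, Real.sqrt_sq hκ.le, one_div_one_div]

/-- The monic orthogonal polynomial of degree `N + 1` is `X Φ`, which vanishes at `0`. -/
lemma verblunsky_circleMeasure (hd : φ.natDegree = N)
    (hr : ∀ a : ℂ, φ.eval a = 0 → ‖a‖ < 1) (hκ : 0 < κ) (hΦ : Φ.Monic)
    (hφ : φ = C (κ : ℂ) * Φ) :
    verblunsky (circleMeasure (bernsteinWeight φ)) N = 0 := by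
  rw [verblunsky, monicOP_circleMeasure hd hr hκ hΦ hφ 1]
  simp

end Bernstein

/-! ### Evaluation of `G`, `D`, `J` and `h`. -/

section Field

variable {N : ℕ} {φ : ℂ[X]}

lemma eval_weightNum (N : ℕ) (φ : ℂ[X]) (z : ℂ) :
    (weightNum N φ).eval z = N * (φ.eval z * (revPoly N φ).eval z)
      - z * ((derivative φ).eval z * (revPoly N φ).eval z
        + φ.eval z * (derivative (revPoly N φ)).eval z) := by
  simp [weightNum, derivative_mul]

lemma natDegree_weightNum_le (hd : φ.natDegree = N) : (weightNum N φ).natDegree ≤ 2 * N := by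
  have hW : (φ * revPoly N φ).natDegree ≤ 2 * N :=
    natDegree_mul_le.trans (by have := natDegree_revPoly_le hd.le; omega)
  refine (natDegree_sub_le _ _).trans (max_le ((natDegree_C_mul_le _ _).trans hW) ?_)
  rcases Nat.eq_zero_or_pos (φ * revPoly N φ).natDegree with h | h
  · rw [natDegree_eq_zero.1 h |>.choose_spec.symm]
    simp
  · refine natDegree_mul_le.trans ?_
    have := natDegree_derivative_lt h.ne'
    rw [natDegree_X]
    omega

/-- The leading terms of `N φ` and of `z` times the derivative of `φ` cancel. -/
lemma natDegree_sub_X_mul_derivative_lt (hN : 1 ≤ N) (hd : φ.natDegree = N) :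
    (C (N : ℂ) * φ - X * derivative φ).natDegree < N := by
  refine ((natDegree_le_iff_coeff_eq_zero (n := N - 1)).2 fun i hi => ?_).trans_lt (by omega)
  obtain ⟨i, rfl⟩ : ∃ k, i = k + 1 := ⟨i - 1, by omega⟩
  rw [coeff_sub, coeff_C_mul, coeff_X_mul, coeff_derivative]
  by_cases h : i + 1 = N
  · rw [← h]; push_cast; ring
  · rw [coeff_eq_zero_of_natDegree_lt (by omega)]; simp

/-- The Cauchy transform of the logarithmic derivative of the weight. -/
lemma circleMean_logDeriv_weight (hN : 1 ≤ N) (hd : φ.natDegree = N) (h0 : φ ≠ 0)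
    (hr : ∀ a : ℂ, φ.eval a = 0 → ‖a‖ < 1) {z : ℂ} (hz : 1 < ‖z‖) :
    circleMean (fun ζ => (N * φ.eval ζ - ζ * (derivative φ).eval ζ) / φ.eval ζ / (z - ζ)
      + -(ζ * (derivative (revPoly N φ)).eval ζ) / ((revPoly N φ).eval ζ * (z - ζ)))
      = (N * φ.eval z - z * (derivative φ).eval z) / φ.eval z / z := by
  have hrev : ∀ ζ : ℂ, ‖ζ‖ ≤ 1 → (revPoly N φ).eval ζ ≠ 0 := fun ζ hζ =>
    hd ▸ eval_revPoly_ne_zero h0 hr hζ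
  have hne : ∀ ζ : ℂ, ‖ζ‖ ≤ 1 → z - ζ ≠ 0 := fun ζ hζ h => by
    rw [sub_eq_zero.1 h] at hz; exact absurd hz hζ.not_gt
  -- The summand with `φ` has its poles in `ζ` inside the disc, apart from `z`. The other has all
  -- its poles outside and a factor `ζ`, so its mean is `0`.
  have hA := circleMean_eval_div_mul_sub (C (N : ℂ) * φ - X * derivative φ) φ
    (by rw [hd]; exact natDegree_sub_X_mul_derivative_lt hN hd) hr hz
  have hB := circleMean_eval_div (-(X * derivative (revPoly N φ))) (revPoly N φ * (C z - X))
    fun ζ hζ => by simpa using ⟨hrev ζ hζ, hne ζ hζ⟩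
  have hcA : ContinuousOn
      (fun ζ => (C (N : ℂ) * φ - X * derivative φ).eval ζ / φ.eval ζ / (z - ζ))
      (Metric.sphere 0 1) := by
    refine (continuousOn_eval_div _ φ fun ζ hζ => ?_).div (by fun_prop) fun ζ hζ => ?_
    · exact eval_ne_zero_of_norm_eq_one hr (by simpa using hζ)
    · exact hne ζ (by simpa using (mem_sphere_iff_norm.1 hζ).le)
  have hcB : ContinuousOn (fun ζ => (-(X * derivative (revPoly N φ))).eval ζ
      / (revPoly N φ * (C z - X)).eval ζ) (Metric.sphere 0 1) := by
    refine continuousOn_eval_div _ _ fun ζ hζ => ?_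
    have : ‖ζ‖ ≤ 1 := by simpa using (mem_sphere_iff_norm.1 hζ).le
    simpa using ⟨hrev ζ this, hne ζ this⟩
  have hAB := circleMean_add hcA hcB
  rw [hA, hB] at hAB
  simpa only [eval_sub, eval_mul, eval_C, eval_X, eval_neg, zero_mul, neg_zero, zero_div,
    add_zero] using hAB

/-- On the circle `|φ^*|² w' = i (N - ζ W' / W)`, and the logarithmic derivative of `W` splits into
those of `φ` and `φ^*`. -/
lemma Gfun_bernsteinWeight (hN : 1 ≤ N) (hd : φ.natDegree = N) (h0 : φ ≠ 0)
    (hr : ∀ a : ℂ, φ.eval a = 0 → ‖a‖ < 1)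
    (ho : orthonormalOP (circleMeasure (bernsteinWeight φ)) N = φ) {z : ℂ} (hz : 1 < ‖z‖) :
    Gfun (bernsteinWeight φ) (N + 1) z
      = -((N * φ.eval z - z * (derivative φ).eval z) / φ.eval z / z) := by
  have hG : Gfun (bernsteinWeight φ) (N + 1) z = Complex.I * circleMean (fun ζ => Complex.I *
      ((N * φ.eval ζ - ζ * (derivative φ).eval ζ) / φ.eval ζ / (z - ζ)
      + -(ζ * (derivative (revPoly N φ)).eval ζ) / ((revPoly N φ).eval ζ * (z - ζ)))) := by
    rw [Gfun, circleMean]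
    simp only [Nat.add_sub_cancel, ho]
    congr 2; ext θ; congr 1
    have h1 := eval_ne_zero_of_norm_eq_one hr (norm_expI θ)
    have h2 : (revPoly N φ).eval (expI θ) ≠ 0 :=
      hd ▸ eval_revPoly_ne_zero h0 hr (norm_expI θ).le
    have h3 : z - expI θ ≠ 0 := fun h => by
      rw [sub_eq_zero.1 h, norm_expI] at hz; exact lt_irrefl _ hz
    have h4 : expI θ ^ N ≠ 0 := pow_ne_zero N (expI_ne_zero θ)
    have h5 := eval_mul_revPoly_of_norm_eq_one hd (norm_expI θ)
    have h6 : ‖(revPoly N φ).eval (expI θ)‖ = ‖φ.eval (expI θ)‖ := by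
      rw [eval_revPoly_of_norm_eq_one hd.le (norm_expI θ)]; simp [norm_expI]
    rw [ofReal_deriv_bernsteinWeight hd hr, h6, eval_weightNum,
      eq_div_of_mul_eq h4 ((mul_comm _ _).trans h5.symm), eval_mul]
    generalize expI θ ^ N = E at *
    field_simp
    ring
  rw [hG, circleMean_const_mul, circleMean_logDeriv_weight hN hd h0 hr hz, ← mul_assoc,
    Complex.I_mul_I, neg_one_mul]

/-- Here `φ^*` cancels, leaving `i (N W - ζ W') / (ζ φ²)`: poles only inside, numerator degree at
most `2 N` against `2 N + 1`. -/
lemma Dfun_bernsteinWeight (hd : φ.natDegree = N) (h0 : φ ≠ 0)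
    (hr : ∀ a : ℂ, φ.eval a = 0 → ‖a‖ < 1)
    (ho : orthonormalOP (circleMeasure (bernsteinWeight φ)) N = φ) {z : ℂ} (hz : 1 < ‖z‖) :
    Dfun (bernsteinWeight φ) (N + 1) z = (weightNum N φ).eval z / (z * φ.eval z ^ 2) := by
  have hrev : ∀ ζ : ℂ, ‖ζ‖ ≤ 1 → (revPoly N φ).eval ζ ≠ 0 := fun ζ hζ =>
    hd ▸ eval_revPoly_ne_zero h0 hr hζ
  have hne : ∀ ζ : ℂ, ‖ζ‖ ≤ 1 → z - ζ ≠ 0 := fun ζ hζ h => by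
    rw [sub_eq_zero.1 h] at hz; exact absurd hz hζ.not_gt
  have hz0 : z ≠ 0 := by rintro rfl; simp at hz; linarith
  have hA := circleMean_eval_div_mul_sub (weightNum N φ) (X * φ ^ 2) (by
      rw [natDegree_mul X_ne_zero (pow_ne_zero 2 h0), natDegree_X, natDegree_pow, hd]
      have := natDegree_weightNum_le hd
      omega) (fun ζ hζ => by
      simp only [eval_mul, eval_X, eval_pow, mul_eq_zero, pow_eq_zero_iff two_ne_zero] at hζ
      rcases hζ with rfl | hζ
      · simp
      · exact hr ζ hζ) hz
  have hI := circleMean_const_mul Complex.I (fun ζ =>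
    (weightNum N φ).eval ζ / (X * φ ^ 2).eval ζ / (z - ζ))
  rw [hA] at hI
  have hD : Dfun (bernsteinWeight φ) (N + 1) z = -Complex.I * z * circleMean (fun ζ => Complex.I *
      ((weightNum N φ).eval ζ / (X * φ ^ 2).eval ζ / (z - ζ))) := by
    rw [Dfun, circleMean]
    simp only [Nat.add_sub_cancel, ho]
    congr 2; ext θ; congr 1
    have h1 := eval_ne_zero_of_norm_eq_one hr (norm_expI θ)
    have h2 := hrev _ (norm_expI θ).le
    have h3 := hne _ (norm_expI θ).le
    have h4 := expI_ne_zero θ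
    rw [ofReal_deriv_bernsteinWeight hd hr]
    simp only [eval_mul, eval_X, eval_pow]
    field_simp
    ring
  rw [hD, hI]
  simp only [eval_mul, eval_X, eval_pow]
  field_simp
  rw [Complex.I_sq]; ring

/-- Here `φ` cancels, leaving `i ζ (N W - ζ W') / (φ^*)²`, analytic in the closed disc and zero at
the origin. -/
lemma Jfun_bernsteinWeight (hd : φ.natDegree = N) (h0 : φ ≠ 0)
    (hr : ∀ a : ℂ, φ.eval a = 0 → ‖a‖ < 1)
    (ho : orthonormalOP (circleMeasure (bernsteinWeight φ)) N = φ) {z : ℂ} (hz : 1 < ‖z‖) :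
    Jfun (bernsteinWeight φ) (N + 1) z = 0 := by
  have hrev : ∀ ζ : ℂ, ‖ζ‖ ≤ 1 → (revPoly N φ).eval ζ ≠ 0 := fun ζ hζ =>
    hd ▸ eval_revPoly_ne_zero h0 hr hζ
  have hne : ∀ ζ : ℂ, ‖ζ‖ ≤ 1 → z - ζ ≠ 0 := fun ζ hζ h => by
    rw [sub_eq_zero.1 h] at hz; exact absurd hz hζ.not_gt
  have hB := circleMean_eval_div (C Complex.I * X * weightNum N φ)
    (revPoly N φ ^ 2 * (C z - X)) fun ζ hζ => by simpa using ⟨hrev ζ hζ, hne ζ hζ⟩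
  rw [eval_mul, eval_mul, eval_X, mul_zero, zero_mul, zero_div] at hB
  have hJ : Jfun (bernsteinWeight φ) (N + 1) z = Complex.I * circleMean (fun ζ =>
      (C Complex.I * X * weightNum N φ).eval ζ / (revPoly N φ ^ 2 * (C z - X)).eval ζ) := by
    rw [Jfun, circleMean]
    simp only [Nat.add_sub_cancel, ho]
    congr 2; ext θ; congr 1
    have h1 := eval_ne_zero_of_norm_eq_one hr (norm_expI θ)
    have h2 := hrev _ (norm_expI θ).le
    have h3 := hne _ (norm_expI θ).le
    have h4 := expI_ne_zero θ
    have h5 : expI θ ^ (((N + 1 : ℕ) : ℤ) - 2) = expI θ ^ N / expI θ := by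
      rw [show ((N + 1 : ℕ) : ℤ) - 2 = (N : ℤ) - 1 by push_cast; ring, zpow_sub₀ h4]
      simp
    rw [ofReal_deriv_bernsteinWeight hd hr, h5]
    simp only [eval_mul, eval_X, eval_pow, eval_C, eval_sub]
    field_simp
  rw [hJ, hB, mul_zero]

/-- The numerator of `h_n(z; β; β)` over the denominator `z φ²`, where `b = conj β`. -/
noncomputable def fieldNum (N : ℕ) (φ : ℂ[X]) (b : ℂ) : ℂ[X] :=
  C b * (C (1 - (N : ℂ)) * (X * φ ^ 2) + C 2 * (X ^ 2 * φ * derivative φ) + C b * weightNum N φ)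

/-- With `α_N = 0` and `J = 0`, `h = b (N + 1 + 2 z G + b D)`; the `-2 N` contained in `2 z G`
accounts for the coefficient `1 - N` in `fieldNum`. -/
lemma hfun_bernsteinWeight (hN : 1 ≤ N) (hd : φ.natDegree = N) (h0 : φ ≠ 0)
    (hr : ∀ a : ℂ, φ.eval a = 0 → ‖a‖ < 1)
    (ho : orthonormalOP (circleMeasure (bernsteinWeight φ)) N = φ)
    (hv : verblunsky (circleMeasure (bernsteinWeight φ)) N = 0) (β : ℂ) {z : ℂ} (hz : 1 < ‖z‖) :
    hfun (bernsteinWeight φ) (N + 1) z β β * (X * φ ^ 2).eval z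
      = (fieldNum N φ ((starRingEnd ℂ) β)).eval z := by
  have hz0 : z ≠ 0 := by rintro rfl; simp at hz; linarith
  have hφz : φ.eval z ≠ 0 := fun h => (hr z h).not_gt hz
  rw [hfun, Gfun_bernsteinWeight hN hd h0 hr ho hz, Dfun_bernsteinWeight hd h0 hr ho hz,
    Jfun_bernsteinWeight hd h0 hr ho hz, Nat.add_sub_cancel, hv, fieldNum]
  simp only [eval_mul, eval_add, eval_X, eval_pow, eval_C]
  push_cast
  field_simp
  ring

end Field

/-! ### Logarithmic derivatives and the equilibrium identity. -/

section Electrostatics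

lemma eval_derivative_prod_X_sub_C {ι : Type*} (s : Finset ι) (y : ι → ℂ) {z : ℂ}
    (h : ∀ k ∈ s, z ≠ y k) : (derivative (∏ k ∈ s, (X - C (y k)))).eval z
      = (∏ k ∈ s, (X - C (y k))).eval z * ∑ k ∈ s, 1 / (z - y k) := by
  classical
  induction s using Finset.induction_on with
  | empty => simp
  | insert k s hk ih =>
    have hne : z - y k ≠ 0 := sub_ne_zero.2 (h k (Finset.mem_insert_self k s))
    rw [Finset.prod_insert hk, Finset.sum_insert hk, derivative_mul, eval_add, eval_mul, eval_mul,
      eval_mul, ih fun j hj => h j (Finset.mem_insert_of_mem hj)]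
    simp only [derivative_X_sub_C, eval_one, eval_sub, eval_X, eval_C]
    field_simp

/-- The interaction of the point `x j` with the other points, in terms of the nodal polynomial. -/
lemma eval_derivative_nodal {n : ℕ} {x : Fin n → ℂ} (hx : Function.Injective x) (j : Fin n) :
    (derivative (∏ k, (X - C (x k)))).eval (x j) ≠ 0 ∧
    (derivative (derivative (∏ k, (X - C (x k))))).eval (x j)
      = 2 * (derivative (∏ k, (X - C (x k)))).eval (x j)
        * ∑ k ∈ Finset.univ.erase j, 1 / (x j - x k) := by
  have hne : ∀ k ∈ Finset.univ.erase j, x j ≠ x k := fun k hk h =>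
    (Finset.mem_erase.1 hk).1 (hx h).symm
  have hR := eval_derivative_prod_X_sub_C (Finset.univ.erase j) x hne
  rw [← Finset.mul_prod_erase Finset.univ _ (Finset.mem_univ j)]
  set R : ℂ[X] := ∏ k ∈ Finset.univ.erase j, (X - C (x k)) with hRdef
  have hR0 : R.eval (x j) ≠ 0 := by
    rw [hRdef, eval_prod]
    exact Finset.prod_ne_zero_iff.2 fun k hk => by simpa [sub_eq_zero] using hne k hk
  have h1 : (derivative ((X - C (x j)) * R)).eval (x j) = R.eval (x j) := by
    simp [derivative_mul]
  have h2 : (derivative (derivative ((X - C (x j)) * R))).eval (x j)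
      = 2 * (derivative R).eval (x j) := by
    simp [derivative_mul]; ring
  rw [h1, h2, hR]
  exact ⟨hR0, by ring⟩

lemma sum_rootMultiplicity_div {S : ℂ[X]} {z : ℂ} (hz : S.eval z ≠ 0) {T : Finset ℂ}
    (hT : S.roots.toFinset ⊆ T) :
    ∑ a ∈ T, (S.rootMultiplicity a : ℂ) / (z - a) = (derivative S).eval z / S.eval z := by
  rw [(IsAlgClosed.splits S).eval_derivative_div_eval_of_ne_zero hz,
    Finset.sum_multiset_map_count]
  symm
  rw [Finset.sum_subset hT]
  · refine Finset.sum_congr rfl fun a _ => ?_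
    rw [count_roots, nsmul_eq_mul, mul_one_div]
  · intro a _ ha
    rw [Multiset.count_eq_zero.2 (by simpa using ha), zero_smul]

lemma sum_genCharge {n : ℕ} {S₁ S₂ : ℂ[X]} {z : ℂ} (h₁ : S₁.eval z ≠ 0) (h₂ : S₂.eval z ≠ 0) :
    ∑ a : genPoints S₁ S₂, (genCharge n S₁ S₂ a : ℂ) / (z - a)
      = 1 / 2 * ((derivative S₂).eval z / S₂.eval z - (derivative S₁).eval z / S₁.eval z)
        + (1 - n) / 2 / z := by
  rw [Finset.sum_coe_sort (genPoints S₁ S₂) (fun a => (genCharge n S₁ S₂ a : ℂ) / (z - a))]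
  rw [← sum_rootMultiplicity_div h₁ (T := genPoints S₁ S₂)
      (Finset.subset_union_left.trans (Finset.subset_insert _ _)),
    ← sum_rootMultiplicity_div h₂ (T := genPoints S₁ S₂)
      (Finset.subset_union_right.trans (Finset.subset_insert _ _)),
    ← Finset.sum_sub_distrib, Finset.mul_sum]
  have h0 : (1 - (n : ℂ)) / 2 / z
      = ∑ a ∈ genPoints S₁ S₂, (if a = 0 then (1 - (n : ℂ)) / 2 else 0) / (z - a) := by
    rw [Finset.sum_eq_single_of_mem 0 (show 0 ∈ genPoints S₁ S₂ from Finset.mem_insert_self _ _)]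
    · simp
    · intro a _ ha
      simp [ha]
  rw [h0, ← Finset.sum_add_distrib]
  refine Finset.sum_congr rfl fun a _ => ?_
  unfold genCharge
  push_cast
  split_ifs <;> push_cast <;> ring

variable {N : ℕ} {φ : ℂ[X]} {b z : ℂ}

/-- At a zero of `z φ - b φ^*`, the numerator is a multiple of the derivative of this
polynomial. -/
lemma eval_fieldNum (hz : z * φ.eval z = b * (revPoly N φ).eval z) :
    (fieldNum N φ b).eval z
      = b * z * φ.eval z * (derivative (X * φ - C b * revPoly N φ)).eval z := by
  rw [fieldNum]
  simp only [eval_mul, eval_add, eval_sub, eval_C, eval_X, eval_pow, eval_weightNum,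
    derivative_mul, derivative_sub, derivative_X, derivative_C, eval_one, eval_zero]
  linear_combination (-b * (N * φ.eval z - z * (derivative φ).eval z)) * hz

/-- `eval_fieldNum` holds only at zeros of `P` and cannot be differentiated. The derivative comes
from the polynomial identity `fieldNum = b z φ P' - b (N φ - z φ') P`, whose last term contributes a
multiple of `P'`. -/
lemma eval_derivative_fieldNum (hz : z * φ.eval z = b * (revPoly N φ).eval z) :
    (derivative (fieldNum N φ b)).eval z
      = b * (z * φ.eval z * (derivative (derivative (X * φ - C b * revPoly N φ))).eval z
        + (derivative (X * φ - C b * revPoly N φ)).eval z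
          * ((1 - N) * φ.eval z + 2 * z * (derivative φ).eval z)) := by
  rw [fieldNum, weightNum]
  simp only [eval_mul, eval_add, eval_sub, eval_C, eval_X, eval_pow, derivative_add,
    derivative_mul, derivative_sub, derivative_X, derivative_C, eval_one, eval_zero,
    derivative_pow, derivative_one, derivative_zero]
  push_cast
  linear_combination (-b * ((N - 1) * (derivative φ).eval z
    - z * (derivative (derivative φ)).eval z)) * hz

/-- Equilibrium at a zero `z` of `X φ - b φ^*`. -/
lemma field_eq_zero (hb : b ≠ 0) (hz0 : z ≠ 0) (hφ : φ.eval z ≠ 0)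
    (hz : z * φ.eval z = b * (revPoly N φ).eval z)
    (hP : (derivative (X * φ - C b * revPoly N φ)).eval z ≠ 0) {S₁ S₂ : ℂ[X]}
    (hS : S₁ * (X * φ ^ 2) = S₂ * fieldNum N φ b)
    (hcop : ¬ (S₁.eval z = 0 ∧ S₂.eval z = 0)) :
    S₁.eval z ≠ 0 ∧ S₂.eval z ≠ 0 ∧
    (derivative (derivative (X * φ - C b * revPoly N φ))).eval z
        / (derivative (X * φ - C b * revPoly N φ)).eval z
      + ((derivative S₂).eval z / S₂.eval z - (derivative S₁).eval z / S₁.eval z) - N / z = 0 := by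
  have e0 := congrArg (eval z) hS
  have e1 := congrArg (eval z) (congrArg derivative hS)
  simp only [derivative_mul, eval_add, eval_mul, eval_pow, eval_X, derivative_X, eval_one,
    derivative_pow, eval_fieldNum hz, eval_derivative_fieldNum hz, eval_C] at e0 e1
  set p1 := (derivative (X * φ - C b * revPoly N φ)).eval z
  set p2 := (derivative (derivative (X * φ - C b * revPoly N φ))).eval z
  -- At `z` the cofactors `z φ²` and `b z φ P'` are nonzero, so `S₁` and `S₂` could vanish only
  -- together.
  have h1 : S₁.eval z ≠ 0 := by
    intro h
    refine hcop ⟨h, ?_⟩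
    rw [h, zero_mul] at e0
    simpa [hb, hz0, hφ, hP] using e0.symm
  have h2 : S₂.eval z ≠ 0 := by
    intro h
    refine hcop ⟨?_, h⟩
    rw [h, zero_mul] at e0
    simpa [hz0, hφ] using e0
  refine ⟨h1, h2, ?_⟩
  have e0' : S₁.eval z * φ.eval z = S₂.eval z * b * p1 := by
    refine mul_right_cancel₀ (mul_ne_zero hz0 hφ) ?_
    linear_combination e0
  push_cast at e1
  -- The equality of logarithmic derivatives with denominators cleared; it is obtained up to the
  -- factor `φ(z)²`, and the terms in `φ'` cancel.
  have hG : z * S₁.eval z * S₂.eval z * p2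
      + z * p1 * ((derivative S₂).eval z * S₁.eval z - (derivative S₁).eval z * S₂.eval z)
      - N * p1 * S₁.eval z * S₂.eval z = 0 := by
    refine (mul_eq_zero.1 ?_).resolve_left (pow_ne_zero 2 hφ)
    linear_combination (-(S₂.eval z * p1)) * e1 + ((derivative S₂).eval z * z * φ.eval z * p1
      + S₂.eval z * z * φ.eval z * p2
      + S₂.eval z * p1 * ((1 - N) * φ.eval z + 2 * z * (derivative φ).eval z)) * e0'
  field_simp
  linear_combination hG

end Electrostatics

/-! ### Specialization to the given points. -/

section Points

variable {N : ℕ} {x : Fin (N + 1) → ℂ}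

lemma integral_norm_monicOP_pos (hx : Function.Injective x) :
    0 < ∫ z, ‖(monicOP (uniformMeasure x) N).eval z‖ ^ 2 ∂(uniformMeasure x) := by
  have hne := (definiteBelow_uniformMeasure hx).polyInner_monicOP_ne_zero (Nat.lt_succ_self N)
  rw [polyInner_self] at hne
  exact lt_of_le_of_ne (integral_nonneg fun z => by positivity) fun h => hne (by rw [← h]; simp)

lemma natDegree_orthonormalOP (hx : Function.Injective x) :
    (orthonormalOP (uniformMeasure x) N).natDegree = N := by
  have := integral_norm_monicOP_pos hx
  rw [orthonormalOP, natDegree_C_mul (by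
    rw [Complex.ofReal_ne_zero]; positivity), natDegree_monicOP]

lemma norm_lt_one_of_eval_orthonormalOP_eq_zero (hx : Function.Injective x)
    (hx1 : ∀ j, ‖x j‖ = 1) (a : ℂ) (ha : (orthonormalOP (uniformMeasure x) N).eval a = 0) :
    ‖a‖ < 1 := by
  have hpos := integral_norm_monicOP_pos hx
  rw [orthonormalOP, eval_mul, eval_C, mul_eq_zero] at ha
  refine norm_lt_one_of_eval_monicOP_eq_zero (ae_norm_eq_one_uniformMeasure hx1)
    (polyIntegrable_uniformMeasure N.succ_ne_zero x) (definiteBelow_uniformMeasure hx)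
    (Nat.lt_succ_self N) (ha.resolve_left ?_)
  rw [Complex.ofReal_eq_zero]; positivity

lemma bsWeight_eq : bsWeight x = bernsteinWeight (orthonormalOP (uniformMeasure x) N) := rfl

/-- The Bernstein–Szegő measure is a probability measure. -/
lemma isProbabilityMeasure_bsWeight (hx : Function.Injective x) (hx1 : ∀ j, ‖x j‖ = 1) :
    IsProbabilityMeasure (circleMeasure (bsWeight x)) := by
  rw [bsWeight_eq]
  have hd := natDegree_orthonormalOP hx
  have hr := norm_lt_one_of_eval_orthonormalOP_eq_zero hx hx1
  have hpos := integral_norm_monicOP_pos hx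
  have hκ : 0 < 1 / √(∫ z, ‖(monicOP (uniformMeasure x) N).eval z‖ ^ 2 ∂(uniformMeasure x)) := by
    positivity
  have hM := monicOP_circleMeasure hd hr hκ (monicOP_monic _ N) rfl 0
  rw [add_zero, pow_zero, one_mul] at hM
  have hself := polyInner_self_circleMeasure hd hr
  set ν := circleMeasure (bernsteinWeight (orthonormalOP (uniformMeasure x) N)) with hν
  -- `φ = Φ / ‖Φ‖_μ` has norm `1` in `L²(ν)`, so `Φ` has the same norm in both spaces.
  have hnorm : polyInner ν (monicOP (uniformMeasure x) N) (monicOP (uniformMeasure x) N)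
      = polyInner (uniformMeasure x) (monicOP (uniformMeasure x) N)
        (monicOP (uniformMeasure x) N) := by
    rw [polyInner_self] at hself
    rw [polyInner_self, polyInner_self]
    have h1 : ∫ z, ‖(orthonormalOP (uniformMeasure x) N).eval z‖ ^ 2 ∂ν = 1 := by
      exact_mod_cast hself
    simp only [orthonormalOP, eval_mul, eval_C, norm_mul, mul_pow, integral_const_mul,
      Complex.norm_real, Real.norm_eq_abs, sq_abs, div_pow, one_pow, Real.sq_sqrt hpos.le] at h1
    rw [one_div, inv_mul_eq_one₀ hpos.ne'] at h1
    rw [h1]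
  have hmass := polyInner_one_one_eq (ae_norm_eq_one_uniformMeasure hx1)
    (ae_norm_eq_one_circleMeasure _) (polyIntegrable_uniformMeasure N.succ_ne_zero x)
    (polyIntegrable_circleMeasure (continuous_bernsteinWeight hr))
    (definiteBelow_uniformMeasure hx) (definiteBelow_circleMeasure hr (N + 1)) hM hnorm
  have h1 : polyInner (uniformMeasure x) 1 1 = 1 := by
    rw [polyInner, integral_uniformMeasure]
    have : (N : ℂ) + 1 ≠ 0 := by exact_mod_cast N.succ_ne_zero
    simp [this]
  have hfin := isFiniteMeasure_circleMeasure (continuous_bernsteinWeight hr)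
  rw [h1, polyInner_self] at hmass
  have h2 : ν.real Set.univ = 1 := by
    have : ∫ z, ‖(1 : ℂ[X]).eval z‖ ^ 2 ∂ν = 1 := by exact_mod_cast hmass
    simpa using this
  refine ⟨?_⟩
  rw [← ENNReal.toReal_eq_one_iff]
  exact h2

lemma hfun_bsWeight (hN : 1 ≤ N) (hx : Function.Injective x) (hx1 : ∀ j, ‖x j‖ = 1) {z : ℂ}
    (hz : 1 < ‖z‖) :
    hfun (bsWeight x) (N + 1) z (betaOf x) (betaOf x)
        * (X * orthonormalOP (uniformMeasure x) N ^ 2).eval z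
      = (fieldNum N (orthonormalOP (uniformMeasure x) N)
        ((starRingEnd ℂ) (betaOf x))).eval z := by
  rw [bsWeight_eq]
  have hd := natDegree_orthonormalOP hx
  have hr := norm_lt_one_of_eval_orthonormalOP_eq_zero hx hx1
  have hpos := integral_norm_monicOP_pos hx
  have hκ : 0 < 1 / √(∫ z, ‖(monicOP (uniformMeasure x) N).eval z‖ ^ 2 ∂(uniformMeasure x)) := by
    positivity
  have h0 : orthonormalOP (uniformMeasure x) N ≠ 0 := by
    intro h; rw [h, natDegree_zero] at hd; omega
  exact hfun_bernsteinWeight hN hd h0 hr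
    (orthonormalOP_circleMeasure hd hr hκ (monicOP_monic _ N) rfl)
    (verblunsky_circleMeasure hd hr hκ (monicOP_monic _ N) rfl) _ hz

lemma exists_popuc_orthonormalOP (hx : Function.Injective x) (hx1 : ∀ j, ‖x j‖ = 1) :
    ∃ c : ℂ, c ≠ 0 ∧ X * orthonormalOP (uniformMeasure x) N
      - C ((starRingEnd ℂ) (betaOf x)) * revPoly N (orthonormalOP (uniformMeasure x) N)
      = C c * ∏ j, (X - C (x j)) := by
  have hpos := integral_norm_monicOP_pos hx
  refine ⟨((1 / √(∫ z, ‖(monicOP (uniformMeasure x) N).eval z‖ ^ 2 ∂(uniformMeasure x)) : ℝ) : ℂ),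
    by rw [Complex.ofReal_ne_zero]; positivity, ?_⟩
  rw [← prod_X_sub_C_eq_popuc hx hx1, orthonormalOP, revPoly, revPoly, Polynomial.map_mul, map_C,
    Complex.conj_ofReal, reflect_C_mul]
  ring

lemma infinite_one_lt_norm : {z : ℂ | 1 < ‖z‖}.Infinite := by
  refine ((Set.Ioi_infinite (1 : ℝ)).image Complex.ofReal_injective.injOn).mono ?_
  rintro _ ⟨t, ht, rfl⟩
  have ht' : (1 : ℝ) < t := ht
  simpa [abs_of_pos (one_pos.trans ht')] using ht'

lemma exists_isCoprime_represents (hN : 1 ≤ N) (hx : Function.Injective x)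
    (hx1 : ∀ j, ‖x j‖ = 1) : ∃ S₁ S₂ : ℂ[X], IsCoprime S₁ S₂ ∧
      Represents S₁ S₂ (fun z => hfun (bsWeight x) (N + 1) z (betaOf x) (betaOf x)) := by
  set φ := orthonormalOP (uniformMeasure x) N with hφdef
  have hr := norm_lt_one_of_eval_orthonormalOP_eq_zero hx hx1
  have h0 : φ ≠ 0 := by
    intro h; have := natDegree_orthonormalOP hx; rw [← hφdef, h, natDegree_zero] at this; omega
  have hH2 : X * φ ^ 2 ≠ 0 := mul_ne_zero X_ne_zero (pow_ne_zero 2 h0)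
  obtain ⟨S₁, S₂, c, hrel, h1, h2⟩ := UniqueFactorizationMonoid.exists_reduced_factors'
    (fieldNum N φ ((starRingEnd ℂ) (betaOf x))) (X * φ ^ 2) hH2
  refine ⟨S₁, S₂, hrel.isCoprime, ?_, fun z hz => ?_⟩
  · rintro rfl; exact hH2 (by rw [← h2, mul_zero])
  · have hz0 : z ≠ 0 := by rintro rfl; simp at hz; linarith
    have hφz : φ.eval z ≠ 0 := fun h => (hr z h).not_gt hz
    have key := hfun_bsWeight hN hx hx1 hz
    rw [← hφdef] at key
    -- The common factor `c` divides `X φ²`, whose zeros all lie in the open disc.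
    have hc : c.eval z ≠ 0 := by
      intro h
      have := congrArg (eval z) h2
      simp [h, hz0, hφz] at this
    rw [← h1, ← h2, eval_mul, eval_mul] at key
    refine mul_left_cancel₀ hc ?_
    linear_combination key

lemma totalEquilibrium_of_represents (hN : 1 ≤ N) (hx : Function.Injective x)
    (hx1 : ∀ j, ‖x j‖ = 1) (S₁ S₂ : ℂ[X]) (hcop : ∀ j, ¬ (S₁.eval (x j) = 0 ∧ S₂.eval (x j) = 0))
    (hrep : Represents S₁ S₂
      (fun z => hfun (bsWeight x) (N + 1) z (betaOf x) (betaOf x))) :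
    (∀ j, x j ∉ genPoints S₁ S₂) ∧
      TotalEquilibrium x (fun a : genPoints S₁ S₂ => (a : ℂ))
        (fun a : genPoints S₁ S₂ => genCharge (N + 1) S₁ S₂ a) := by
  set φ := orthonormalOP (uniformMeasure x) N with hφdef
  set b := (starRingEnd ℂ) (betaOf x) with hbdef
  have hx0 : ∀ j, x j ≠ 0 := fun j h => by have := hx1 j; simp [h] at this
  have hb : b ≠ 0 := by
    simp [hbdef, betaOf, Finset.prod_eq_zero_iff, hx0]
  have hr := norm_lt_one_of_eval_orthonormalOP_eq_zero hx hx1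
  -- Two representations of `h` on the infinite set `|z| > 1` give a polynomial identity, which can
  -- then be evaluated at the nodes on the circle.
  have hS : S₁ * (X * φ ^ 2) = S₂ * fieldNum N φ b := by
    refine eq_of_infinite_eval_eq _ _ (infinite_one_lt_norm.mono fun z hz => ?_)
    have h1 := hrep.2 z hz
    have h2 := hfun_bsWeight hN hx hx1 hz
    change (S₁ * (X * φ ^ 2)).eval z = (S₂ * fieldNum N φ b).eval z
    rw [← hφdef, ← hbdef] at h2
    rw [eval_mul (p := S₁), eval_mul (p := S₂), ← h1, ← h2]
    ring
  obtain ⟨c, hc, hP⟩ := exists_popuc_orthonormalOP hx hx1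
  have key : ∀ j, S₁.eval (x j) ≠ 0 ∧ S₂.eval (x j) ≠ 0 ∧
      2 * ∑ k ∈ Finset.univ.erase j, 1 / (x j - x k)
        + ((derivative S₂).eval (x j) / S₂.eval (x j)
          - (derivative S₁).eval (x j) / S₁.eval (x j)) - N / x j = 0 := by
    intro j
    obtain ⟨hQ1, hQ2⟩ := eval_derivative_nodal hx j
    have hz : x j * φ.eval (x j) = b * (revPoly N φ).eval (x j) := by
      have := congrArg (eval (x j)) hP
      rw [eval_mul (p := C c), eval_prod, Finset.prod_eq_zero (Finset.mem_univ j) (by simp)] at this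
      simpa [sub_eq_zero] using this
    have hd1 : (derivative (X * φ - C b * revPoly N φ)).eval (x j)
        = c * (derivative (∏ k, (X - C (x k)))).eval (x j) := by
      rw [hP, derivative_C_mul, eval_mul, eval_C]
    have hd2 : (derivative (derivative (X * φ - C b * revPoly N φ))).eval (x j)
        = c * (derivative (derivative (∏ k, (X - C (x k))))).eval (x j) := by
      rw [hP, derivative_C_mul, derivative_C_mul, eval_mul, eval_C]
    have h := field_eq_zero hb (hx0 j) (eval_ne_zero_of_norm_eq_one hr (hx1 j)) hz
      (by rw [hd1]; exact mul_ne_zero hc hQ1) hS (hcop j)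
    rw [hd1, hd2, mul_div_mul_left _ _ hc, hQ2, mul_right_comm, mul_div_cancel_right₀ _ hQ1] at h
    exact h
  refine ⟨fun j hj => ?_, fun j => ?_⟩
  · obtain ⟨h1, h2, -⟩ := key j
    simp only [genPoints, Finset.mem_insert, Finset.mem_union, Multiset.mem_toFinset] at hj
    rcases hj with hj | hj | hj
    · exact hx0 j hj
    · exact h1 (isRoot_of_mem_roots hj)
    · exact h2 (isRoot_of_mem_roots hj)
  · obtain ⟨h1, h2, h3⟩ := key j
    have := sum_genCharge (n := N + 1) h1 h2
    simp only at this ⊢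
    rw [this]
    push_cast
    linear_combination (1 / 2) * h3

end Points

end CircleElectro

open CircleElectro Polynomial MeasureTheory in
theorem mainTheorem5 (n : ℕ) (hn : 2 ≤ n) (x : Fin n → ℂ) (hx : Function.Injective x)
    (hx1 : ∀ j, ‖x j‖ = 1) :
    -- existence of a set of electric field generators
    (∃ (m : ℕ) (a : Fin m → ℂ) (q : Fin m → ℝ), Function.Injective a ∧
        (∀ i j, a i ≠ x j) ∧ TotalEquilibrium x a q) ∧
    -- the explicit construction: the Bernstein–Szegő measure is a probability measure,
    IsProbabilityMeasure (circleMeasure (bsWeight x)) ∧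
    -- its function `h_n(z; β; β)` is, for `|z| > 1`, a rational function `S₁ / S₂`,
    (∃ S₁ S₂ : ℂ[X], IsCoprime S₁ S₂ ∧
        Represents S₁ S₂ (fun z => hfun (bsWeight x) n z (betaOf x) (betaOf x))) ∧
    -- and every such quotient without common zeros at the `x_j` yields generators.
    (∀ S₁ S₂ : ℂ[X], (∀ j, ¬ (S₁.eval (x j) = 0 ∧ S₂.eval (x j) = 0)) →
        Represents S₁ S₂ (fun z => hfun (bsWeight x) n z (betaOf x) (betaOf x)) →
        (∀ j, x j ∉ genPoints S₁ S₂) ∧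
        TotalEquilibrium x (fun a : genPoints S₁ S₂ => (a : ℂ))
          (fun a : genPoints S₁ S₂ => genCharge n S₁ S₂ a)) := by
  obtain ⟨N, rfl⟩ : ∃ N, n = N + 1 := ⟨n - 1, by omega⟩
  have hN : 1 ≤ N := by omega
  have hex := exists_isCoprime_represents hN hx hx1
  have hall := totalEquilibrium_of_represents hN hx hx1
  refine ⟨?_, isProbabilityMeasure_bsWeight hx hx1, hex, hall⟩
  obtain ⟨S₁, S₂, ⟨u, v, huv⟩, hrep⟩ := hex
  -- Evaluating the Bézout relation at a common zero would give `0 = 1`.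
  obtain ⟨hnot, heq⟩ := hall S₁ S₂ (fun j h => by
    have := congrArg (eval (x j)) huv
    simp [h.1, h.2] at this) hrep
  let e := (genPoints S₁ S₂).equivFin
  refine ⟨_, fun i => (e.symm i : ℂ), fun i => genCharge (N + 1) S₁ S₂ (e.symm i),
    Subtype.val_injective.comp e.symm.injective, fun i j h => ?_, fun j => ?_⟩
  · exact hnot j (h ▸ (e.symm i).2)
  · rw [← heq j]
    congr 1
    exact e.symm.sum_comp fun a : genPoints S₁ S₂ =>
      (genCharge (N + 1) S₁ S₂ a : ℂ) / (x j - a)
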